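/- Let $K=1154$, and let $\lambda_0=1$, $\lambda_1=2.012$, $\lambda_2=5.10$, $\lambda_3=15.55$, $\lambda_4=55.45$, $\lambda_5=220.40$ and $\nu_i=\sqrt[i+1]{(i+1)\lambda_i}$. For $0\le i\le 5$ consider the linear program, of constant size, in the variables $\Psi, g(0),\dots,g(K)$: $$\min \Psi \quad\text{s.t.}\quad \Psi m^{i+1}-m\,g(n+1)+n\,g(n)\ \ge\ n^{i+1}\ \ (0\le n<K,\ 0\le m\le (K+1)^2),\qquad g(K)\ge \nu_i K^i,\qquad g\ge 0 .$$ 1. Each of these programs has an optimal solution. Its optimal value $\Psi_i$ satisfies $|\Psi_1-2.012|\le 0.0005$, and $|\Psi_2-5.10|$, $|\Psi_3-15.55|$, $|\Psi_4-55.45|$, $|\Psi_5-220.40|\le 0.005$. For optimal solutions $(\Psi_i,g_i)$ put $\hat g_i(n)=g_i(n)$ for $n\le K$ and $\hat g_i(n)=\nu_i n^i$ for $n>K$. For a polynomial cost function $f_e(x)=\sum_i a_{e,i}x^i$ with $a_{e,i}\ge 0$ let the taxed cost function be $f'_e(n)=\sum_i a_{e,i}\,\hat g_i(n)$; it depends on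 $f_e$ only, and not on the number of players or on the rest of the game. 2. Each taxed cost function can be computed in constant time: there are optimal solutions $g_0,\dots,g_5$ and a constant $T$ such that for each $1\le d\le 5$ there is a program over real registers (with integer constants; each arithmetic operation, root extraction and comparison is one step) that, from the coefficients of any polynomial $f_e$ of degree at most $d$ with nonnegative coefficients, computes in at most $T$ steps the values $f'_e(0),\dots,f'_e(K)$ and the coefficients of the polynomial that gives $f'_e(n)$ for $n>K$. 3. Let $1\le d\le 5$, and let $g_0,\dots,g_d$ be any optimal solutions. For every congestion game with finitely many players and resources, whose cost functions $f_e$ are polynomials of degree at most $d$ with nonnegative coefficients, we have $f'_e\ge 0$, and the game in which players experience the costs $c'_u(s)=\sum_{e\in s_u}f'_e(n_e(s))$ is $(\Psi_d,0)$-smooth with respect to the social cost $c(s)=\sum_u\sum_{e\in s_u} f_e(n_e(s))$ of the original game: for all states $s,s^*$, $$\Psi_d\, c(s^*)\ \ge\ \sum_u c'_u(s^*_u,s_{-u})-\sum_u c'_u(s)+c(s).$$ Consequently, under these refundable universal taxes $f'_e-f_e$ the price of anarchy is at most $\Psi_d$: every pure Nash equilibrium $s$ of the taxed game satisfies $c(s)\le\Psi_d\,c(s^*)$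 for every state $s^*$. -/

import Mathlib

/-! ### Strategic games, smoothness, pure Nash equilibria -/

/-- A cost-minimization game with players `P`; the strategies of all players are taken from `A`. -/
structure StrategicGame (P A : Type*) where
  strategies : P → Finset A
  cost : (P → A) → P → ℝ

namespace StrategicGame

variable {P A : Type*}

/-- `s` is a state (outcome) of the game: every player plays one of her strategies. -/
def IsState (Γ : StrategicGame P A) (s : P → A) : Prop :=
  ∀ u, s u ∈ Γ.strategies u

/-- `(lam, mu)`-smoothness with respect to an objective function `h`. -/
def IsSmooth [Fintype P] [DecidableEq P] (Γ : StrategicGame P A) (lam mu : ℝ)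
    (h : (P → A) → ℝ) : Prop :=
  ∀ s t : P → A, Γ.IsState s → Γ.IsState t →
    ∑ u, Γ.cost (Function.update s u (t u)) u - ∑ u, Γ.cost s u + (1 - mu) * h s ≤ lam * h t

/-- Pure Nash equilibria. -/
def IsPureNash [DecidableEq P] (Γ : StrategicGame P A) (s : P → A) : Prop :=
  Γ.IsState s ∧ ∀ u, ∀ a ∈ Γ.strategies u, Γ.cost s u ≤ Γ.cost (Function.update s u a) u

end StrategicGame

/-! ### Congestion games -/

/-- A congestion game with players `P` and resources `E`: the strategies of a player are sets of
resources, and `cost e k` is what each user of `e` pays when `k` players use `e`. -/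
structure CongestionGame (P E : Type*) where
  strategies : P → Finset (Finset E)
  cost : E → ℕ → ℝ

namespace CongestionGame

variable {P E : Type*} [Fintype P] [DecidableEq E]

/-- The number of players that use the resource `e` in the state `s`. -/
def load (s : P → Finset E) (e : E) : ℕ :=
  (Finset.univ.filter fun u => e ∈ s u).card

/-- The strategic game given by a congestion game. -/
def toStrategicGame (G : CongestionGame P E) : StrategicGame P (Finset E) where
  strategies := G.strategies
  cost s u := ∑ e ∈ s u, G.cost e (load s e)

/-- The social cost: the sum of the costs of all players. -/
def socialCost (G : CongestionGame P E) (s : P → Finset E) : ℝ :=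
  ∑ u, G.toStrategicGame.cost s u

end CongestionGame

/-! ### The linear program for monomial costs -/

/-- The number of values of a cost function that the linear program determines. -/
def taxK : ℕ := 1154

/-- Reference values from which the coefficients of the tails are formed. -/
noncomputable def refLam : ℕ → ℝ
  | 0 => 1
  | 1 => 2.012
  | 2 => 5.10
  | 3 => 15.55
  | 4 => 55.45
  | 5 => 220.40
  | _ => 1

/-- The tail coefficient `ν_i = ((i + 1) λ_i) ^ (1 / (i + 1))`. -/
noncomputable def tailCoeff (i : ℕ) : ℝ :=
  (((i : ℝ) + 1) * refLam i) ^ (1 / ((i : ℝ) + 1))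

/-- Feasibility of `(Ψ, g 0, …, g K)` in the linear program for the cost function `x ↦ x ^ i`, whose
resource objective is `n ↦ n * n ^ i = n ^ (i + 1)`. The program minimizes `Ψ`. -/
structure TaxLPFeasible (i : ℕ) (Ψ : ℝ) (g : Fin (taxK + 1) → ℝ) : Prop where
  smooth : ∀ n : Fin taxK, ∀ m : ℕ, m ≤ (taxK + 1) ^ 2 →
    ((n : ℕ) : ℝ) ^ (i + 1) ≤
      Ψ * (m : ℝ) ^ (i + 1) - (m : ℝ) * g n.succ + ((n : ℕ) : ℝ) * g n.castSucc
  tail : tailCoeff i * (taxK : ℝ) ^ i ≤ g (Fin.last taxK)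
  nonneg : ∀ n, 0 ≤ g n

/-- The set of feasible objective values of the linear program. -/
def taxLPValues (i : ℕ) : Set ℝ :=
  {Ψ | ∃ g, TaxLPFeasible i Ψ g}

/-- The optimal value `Ψ_i` of the linear program. -/
noncomputable def taxLPOpt (i : ℕ) : ℝ :=
  sInf (taxLPValues i)

/-- `g` is the function part of an optimal solution of the linear program. -/
def IsTaxLPSolution (i : ℕ) (g : Fin (taxK + 1) → ℝ) : Prop :=
  taxLPOpt i ∈ lowerBounds (taxLPValues i) ∧ TaxLPFeasible i (taxLPOpt i) g

/-! ### Taxed cost functions -/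

/-- The taxed version of the cost function `x ↦ x ^ i`: the values `g` for loads up to `K`, and
`ν_i n ^ i` beyond. -/
noncomputable def taxedMonomial (i : ℕ) (g : Fin (taxK + 1) → ℝ) (n : ℕ) : ℝ :=
  if h : n ≤ taxK then g ⟨n, Nat.lt_succ_of_le h⟩ else tailCoeff i * (n : ℝ) ^ i

/-- The taxed version `f'` of the polynomial cost function `f = ∑ a_i x ^ i`, where `g i` solves the
linear program for `x ^ i`. The tax at load `n` is `f' n - f n`. -/
noncomputable def taxedCost (g : ℕ → Fin (taxK + 1) → ℝ) (f : Polynomial ℝ) (n : ℕ) : ℝ :=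
  f.sum fun i a => a * taxedMonomial i (g i) n

/-- The game with the same players, resources and strategies in which the users of the resource `e`
experience the taxed version of the polynomial cost function `f e`. -/
noncomputable def CongestionGame.taxed {P E : Type*} (G : CongestionGame P E)
    (g : ℕ → Fin (taxK + 1) → ℝ) (f : E → Polynomial ℝ) : CongestionGame P E where
  strategies := G.strategies
  cost e n := taxedCost g (f e) n

/-! ### Machine model: programs over real registers with unit cost -/

/-- Programs over registers `0, 1, 2, …` that hold real numbers. The only constants are integers. -/
inductive RealProg : Type
  | const (r : ℕ) (z : ℤ)
  | add (r i j : ℕ)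
  | sub (r i j : ℕ)
  | mul (r i j : ℕ)
  | div (r i j : ℕ)
  | root (k r i : ℕ)
  | seq (p q : RealProg)
  | ifLE (i j : ℕ) (p q : RealProg)
  | whileLE (i j : ℕ) (p : RealProg)

/-- `p.Exec σ t τ`: started on the register contents `σ`, the program `p` halts after exactly `t`
steps with register contents `τ`. Each arithmetic operation, each extraction of a root (the `k`-th
root, `k ≥ 1`, of a nonnegative number) and each comparison is one step. -/
inductive RealProg.Exec : RealProg → (ℕ → ℝ) → ℕ → (ℕ → ℝ) → Prop
  | const (σ : ℕ → ℝ) (r : ℕ) (z : ℤ) :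
      Exec (.const r z) σ 1 (Function.update σ r (z : ℝ))
  | add (σ : ℕ → ℝ) (r i j : ℕ) : Exec (.add r i j) σ 1 (Function.update σ r (σ i + σ j))
  | sub (σ : ℕ → ℝ) (r i j : ℕ) : Exec (.sub r i j) σ 1 (Function.update σ r (σ i - σ j))
  | mul (σ : ℕ → ℝ) (r i j : ℕ) : Exec (.mul r i j) σ 1 (Function.update σ r (σ i * σ j))
  | div (σ : ℕ → ℝ) (r i j : ℕ) (hj : σ j ≠ 0) :
      Exec (.div r i j) σ 1 (Function.update σ r (σ i / σ j))
  | root (σ : ℕ → ℝ) (k r i : ℕ) (hk : 1 ≤ k) (hi : 0 ≤ σ i) :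
      Exec (.root k r i) σ 1 (Function.update σ r (σ i ^ (1 / (k : ℝ))))
  | seq {p q : RealProg} {σ τ ρ : ℕ → ℝ} {t t' : ℕ} (hp : Exec p σ t τ) (hq : Exec q τ t' ρ) :
      Exec (.seq p q) σ (t + t') ρ
  | ifTrue {p q : RealProg} {σ τ : ℕ → ℝ} {t i j : ℕ} (h : σ i ≤ σ j) (hp : Exec p σ t τ) :
      Exec (.ifLE i j p q) σ (t + 1) τ
  | ifFalse {p q : RealProg} {σ τ : ℕ → ℝ} {t i j : ℕ} (h : σ j < σ i) (hq : Exec q σ t τ) :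
      Exec (.ifLE i j p q) σ (t + 1) τ
  | whileDone {p : RealProg} {σ : ℕ → ℝ} {i j : ℕ} (h : σ j < σ i) :
      Exec (.whileLE i j p) σ 1 σ
  | whileStep {p : RealProg} {σ τ ρ : ℕ → ℝ} {t t' i j : ℕ} (h : σ i ≤ σ j)
      (hp : Exec p σ t τ) (hw : Exec (.whileLE i j p) τ t' ρ) :
      Exec (.whileLE i j p) σ (t + t' + 1) ρ

/-- The function on `ℕ` described by register contents: a table of the values at `0, …, K` in the
registers `0, …, K`, and the coefficients of a polynomial of degree at most `d`, which gives the
values beyond `K`, in the registers `K + 1, …, K + 1 + d`. -/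
noncomputable def decodeCost (d : ℕ) (σ : ℕ → ℝ) (n : ℕ) : ℝ :=
  if n ≤ taxK then σ n else ∑ i ∈ Finset.range (d + 1), σ (taxK + 1 + i) * (n : ℝ) ^ i

/-- The program `p` computes the taxed cost function of every polynomial of degree at most `d` with
nonnegative coefficients within `T` steps. The input registers `0, …, d` hold the coefficients, and
all other registers are `0`. -/
def RealProg.ComputesTaxedCost (p : RealProg) (d : ℕ) (g : ℕ → Fin (taxK + 1) → ℝ) (T : ℕ) : Prop :=
  ∀ f : Polynomial ℝ, f.natDegree ≤ d → (∀ i, 0 ≤ f.coeff i) →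
    ∃ t ≤ T, ∃ τ : ℕ → ℝ, p.Exec (fun i => f.coeff i) t τ ∧
      ∀ n : ℕ, decodeCost d τ n = taxedCost g f n

/-! Smoothness of the taxed game splits into one inequality per resource and, by linearity, per
monomial. It involves the loads `n`, `m` of the resource in the two states and the number `k` of
players who use it in both. The linear program only states the case `k = 0`, for small loads. The
inequality is affine in `k`, so it suffices to treat the extremes. If the tax does not decrease from
`n` to `n + 1`, then `k = 0` is the worst case; otherwise it is `k = min n m`, and that case follows
from `k = 0` by propagating bounds along `n`, upwards from load 0 or downwards from the tail, with
convexity of `x ^ (i + 1)` (`SmoothAt.upper_bound`, `SmoothAt.lower_bound`, `SmoothAt.overlap`).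

Beyond the table the tax is a pure power, and weighted AM-GM gives smoothness there
(`smooth_of_power_tax`). Since the optimal values increase with the degree, `Ψ_d` serves all
monomials of a polynomial.

For fixed `Ψ` there is a largest tax, given by a greedy recursion (`maxTax`), and `Ψ` is feasible
exactly if this tax passes the remaining lower bounds. It is continuous in `Ψ`, so the optimum is
attained. There a lower bound is tight, which makes `Ψ` and all taxes rational affine functions of
`ν_i`. A program can therefore load them as constants, and what remains is a fixed linear map of the
coefficients. The numerical values come from explicit tables (upper bounds) and from linear
combinations of a few constraints (lower bounds). -/

/-! ### Convexity and the smoothness inequality of one resource. -/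

theorem weighted_am_gm {a b : ℝ} (ha : 0 ≤ a) (hb : 0 ≤ b) (i : ℕ) :
    ((i : ℝ) + 1) * a * b ^ i ≤ a ^ (i + 1) + i * b ^ (i + 1) := by
  induction i with
  | zero => simp
  | succ i ih =>
    have h1 := mul_le_mul_of_nonneg_left ih ha
    have h2 : 0 ≤ ((i : ℝ) + 1) * b ^ i * (a - b) ^ 2 := by positivity
    push_cast
    have e : a ^ (i + 1 + 1) + ((i : ℝ) + 1) * b ^ (i + 1 + 1) - ((i : ℝ) + 1 + 1) * a * b ^ (i + 1)
        = a * (a ^ (i + 1) + i * b ^ (i + 1)) - a * (((i : ℝ) + 1) * a * b ^ i)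
          + ((i : ℝ) + 1) * b ^ i * (a - b) ^ 2 := by ring
    linarith

/-- The tangent of `x ↦ x ^ (i + 1)` at `b` lies below the graph. -/
theorem tangent_le_pow {a b : ℝ} (ha : 0 ≤ a) (hb : 0 ≤ b) (i : ℕ) :
    b ^ (i + 1) + ((i : ℝ) + 1) * b ^ i * (a - b) ≤ a ^ (i + 1) := by
  have h := weighted_am_gm ha hb i
  have e : b ^ (i + 1) + ((i : ℝ) + 1) * b ^ i * (a - b)
      = ((i : ℝ) + 1) * a * b ^ i - i * b ^ (i + 1) := by ring
  linarith

/-- The point `(m, Ψ m ^ (i + 1))` lies on or above the convex graph of `x ^ (i + 1)`, so the slope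
from it to the graph point at `n` grows with `n > m`. Here this is multiplied out; `lower_secant_le`
is the same on the other side of `m`. -/
theorem upper_secant_le {Ψ : ℝ} (hΨ : 1 ≤ Ψ) (i : ℕ) {m n : ℕ} (h : m ≤ n) :
    ((n : ℝ) ^ (i + 1) - Ψ * (m : ℝ) ^ (i + 1)) * (n + 1 - m)
      ≤ (((n : ℝ) + 1) ^ (i + 1) - Ψ * (m : ℝ) ^ (i + 1)) * (n - m) := by
  have h1 := tangent_le_pow (a := (n : ℝ) + 1) (b := n) (by positivity) (by positivity) i
  have h2 := tangent_le_pow (a := (m : ℝ)) (b := n) (by positivity) (by positivity) i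
  have h3 : (m : ℝ) ≤ n := by exact_mod_cast h
  have h4 : 0 ≤ (Ψ - 1) * (m : ℝ) ^ (i + 1) := mul_nonneg (by linarith) (by positivity)
  have h5 := mul_le_mul_of_nonneg_right h1 (sub_nonneg.2 h3)
  nlinarith

theorem lower_secant_le {Ψ : ℝ} (hΨ : 1 ≤ Ψ) (i : ℕ) {m n : ℕ} (h : n + 1 ≤ m) :
    (Ψ * (m : ℝ) ^ (i + 1) - (n : ℝ) ^ (i + 1)) * (m - n - 1)
      ≤ (Ψ * (m : ℝ) ^ (i + 1) - ((n : ℝ) + 1) ^ (i + 1)) * (m - n) := by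
  have h1 := tangent_le_pow (a := (n : ℝ)) (b := n + 1) (by positivity) (by positivity) i
  have h2 := tangent_le_pow (a := (m : ℝ)) (b := n + 1) (by positivity) (by positivity) i
  have h3 : (n : ℝ) + 1 ≤ m := by exact_mod_cast h
  have h4 : 0 ≤ (Ψ - 1) * (m : ℝ) ^ (i + 1) := mul_nonneg (by linarith) (by positivity)
  have h5 := mul_le_mul_of_nonneg_right h1 (sub_nonneg.2 h3)
  nlinarith

/-- The smoothness condition on a tax `h` for the cost function `x ↦ x ^ i`. -/
def SmoothAt (i : ℕ) (Ψ : ℝ) (h : ℕ → ℝ) (n m : ℕ) : Prop :=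
  (n : ℝ) ^ (i + 1) ≤ Ψ * (m : ℝ) ^ (i + 1) - m * h (n + 1) + n * h n

/-- The overlap inequality for `k = n`. Each row bounds the next tax through the previous one, and
monotonicity of the secant slopes is what closes the induction. -/
theorem SmoothAt.upper_bound {i : ℕ} {Ψ : ℝ} {h : ℕ → ℝ} {N m : ℕ} (hΨ : 1 ≤ Ψ)
    (hs : ∀ n < N, SmoothAt i Ψ h n m) {n : ℕ} (hn : n < N) (hm : n < m) :
    ((m : ℝ) - n) * h (n + 1) ≤ Ψ * (m : ℝ) ^ (i + 1) - (n : ℝ) ^ (i + 1) := by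
  induction n with
  | zero =>
    have := hs 0 hn
    simp only [SmoothAt, Nat.cast_zero, zero_mul, add_zero, sub_zero] at this ⊢
    linarith
  | succ n ih =>
    have ih := ih (by omega) (by omega)
    have h1 := lower_secant_le hΨ i (m := m) (n := n) (by omega)
    have h2 := hs (n + 1) hn
    have h3 : (n : ℝ) + 1 < m := by exact_mod_cast hm
    simp only [SmoothAt, Nat.cast_add, Nat.cast_one] at h2 ⊢
    set X := h (n + 1)
    set Y := h (n + 1 + 1)
    set V₁ := Ψ * (m : ℝ) ^ (i + 1) - ((n : ℝ) + 1) ^ (i + 1)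
    set V₀ := Ψ * (m : ℝ) ^ (i + 1) - (n : ℝ) ^ (i + 1)
    have hX : ((m : ℝ) - n - 1) * X ≤ V₁ := by
      have h4 := mul_le_mul_of_nonneg_right ih (by linarith : (0 : ℝ) ≤ m - n - 1)
      refine le_of_mul_le_mul_right ?_ (by linarith : (0 : ℝ) < m - n)
      linarith
    have h5 : (m : ℝ) * Y ≤ V₁ + (n + 1) * X := by linarith
    have h6 := mul_le_mul_of_nonneg_left h5 (by linarith : (0 : ℝ) ≤ m - n - 1)
    have hn0 : (0 : ℝ) ≤ n := n.cast_nonneg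
    have h7 := mul_le_mul_of_nonneg_left hX (by linarith : (0 : ℝ) ≤ n + 1)
    refine le_of_mul_le_mul_left ?_ (by linarith : (0 : ℝ) < m)
    linarith

/-- The overlap inequality for `k = m`. The induction descends from the tail, where `hN` is the
claim itself; a row bounds `h n` from below through `h (n + 1)`. -/
theorem SmoothAt.lower_bound {i : ℕ} {Ψ : ℝ} {h : ℕ → ℝ} (hΨ : 1 ≤ Ψ)
    (hs : ∀ n m, SmoothAt i Ψ h n m) {N : ℕ}
    (hN : ∀ n ≥ N, ∀ m : ℕ,
      (n : ℝ) ^ (i + 1) ≤ Ψ * (m : ℝ) ^ (i + 1) - m * h n + n * h n) (n m : ℕ) (hm : m ≤ n) :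
    (n : ℝ) ^ (i + 1) - Ψ * (m : ℝ) ^ (i + 1) ≤ ((n : ℝ) - m) * h n := by
  obtain ⟨j, hj⟩ : ∃ j, N ≤ n + j := ⟨N, by omega⟩
  induction j generalizing n with
  | zero => have := hN n hj m; linarith
  | succ j ih =>
    have ih := ih (n + 1) (by omega) (by omega)
    rcases hm.eq_or_lt with rfl | hm
    · have : (0 : ℝ) ≤ (Ψ - 1) * (m : ℝ) ^ (i + 1) := mul_nonneg (by linarith) (by positivity)
      linarith
    have h1 := upper_secant_le hΨ i hm.le
    have h2 := hs n m
    have h3 : (m : ℝ) < n := by exact_mod_cast hm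
    have hm0 : (0 : ℝ) ≤ m := m.cast_nonneg
    simp only [SmoothAt, Nat.cast_add, Nat.cast_one] at h2 ih
    set X := h n
    set Y := h (n + 1)
    set W₁ := ((n : ℝ) + 1) ^ (i + 1) - Ψ * (m : ℝ) ^ (i + 1)
    set W₀ := (n : ℝ) ^ (i + 1) - Ψ * (m : ℝ) ^ (i + 1)
    have hY : W₀ ≤ ((n : ℝ) - m) * Y := by
      have h4 := mul_le_mul_of_nonneg_right ih (by linarith : (0 : ℝ) ≤ n - m)
      refine le_of_mul_le_mul_right ?_ (by linarith : (0 : ℝ) < n + 1 - m)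
      linarith
    have h5 : W₀ + m * Y ≤ n * X := by linarith
    have h6 := mul_le_mul_of_nonneg_left h5 (by linarith : (0 : ℝ) ≤ n - m)
    have h7 := mul_le_mul_of_nonneg_left hY hm0
    refine le_of_mul_le_mul_left ?_ (by linarith : (0 : ℝ) < n)
    linarith

/-- The smoothness inequality of one resource that `n` players use in the first state, `m` in the
second one and `k` in both. -/
theorem SmoothAt.overlap {i : ℕ} {Ψ : ℝ} {h : ℕ → ℝ} (hΨ : 1 ≤ Ψ)
    (hs : ∀ n m, SmoothAt i Ψ h n m) {N : ℕ}
    (hN : ∀ n ≥ N, ∀ m : ℕ,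
      (n : ℝ) ^ (i + 1) ≤ Ψ * (m : ℝ) ^ (i + 1) - m * h n + n * h n)
    {n m k : ℕ} (hkn : k ≤ n) (hkm : k ≤ m) :
    ((m : ℝ) - k) * h (n + 1) + k * h n - n * h n + (n : ℝ) ^ (i + 1)
      ≤ Ψ * (m : ℝ) ^ (i + 1) := by
  have h0 := hs n m
  have hk0 : (0 : ℝ) ≤ k := k.cast_nonneg
  have hkn' : (k : ℝ) ≤ n := by exact_mod_cast hkn
  have hkm' : (k : ℝ) ≤ m := by exact_mod_cast hkm
  unfold SmoothAt at h0
  rcases le_total (h n) (h (n + 1)) with hle | hle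
  · nlinarith
  · rcases lt_or_ge n m with hnm | hnm
    · have := SmoothAt.upper_bound hΨ (N := n + 1) (fun n' _ => hs n' m) (by omega) hnm
      nlinarith
    · have := SmoothAt.lower_bound hΨ hs hN n m hnm
      nlinarith

/-! ### From the finite linear program to all loads. -/

theorem taxedMonomial_of_le {i : ℕ} {g : Fin (taxK + 1) → ℝ} {n : ℕ} (h : n ≤ taxK) :
    taxedMonomial i g n = g ⟨n, Nat.lt_succ_of_le h⟩ := dif_pos h

theorem taxedMonomial_of_lt {i : ℕ} {g : Fin (taxK + 1) → ℝ} {n : ℕ} (h : taxK < n) :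
    taxedMonomial i g n = tailCoeff i * (n : ℝ) ^ i := dif_neg (not_le.2 h)

theorem taxK_pos : 0 < taxK := by norm_num [taxK]

namespace TaxLPFeasible

variable {i : ℕ} {Ψ : ℝ} {g : Fin (taxK + 1) → ℝ}

theorem smoothAt (hf : TaxLPFeasible i Ψ g) {n m : ℕ} (hn : n < taxK) (hm : m ≤ (taxK + 1) ^ 2) :
    SmoothAt i Ψ (taxedMonomial i g) n m := by
  unfold SmoothAt
  rw [taxedMonomial_of_le (Nat.succ_le_of_lt hn), taxedMonomial_of_le hn.le]
  exact hf.smooth ⟨n, hn⟩ m hm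

theorem tail' (hf : TaxLPFeasible i Ψ g) :
    tailCoeff i * (taxK : ℝ) ^ i ≤ taxedMonomial i g taxK := by
  rw [taxedMonomial_of_le le_rfl]; exact hf.tail

theorem le_of_lt (hf : TaxLPFeasible i Ψ g) {n : ℕ} (hn : n < taxK) :
    (n : ℝ) ^ (i + 1) ≤ n * taxedMonomial i g n := by
  have := hf.smoothAt hn (Nat.zero_le _)
  simpa [SmoothAt] using this

/-- Smoothness for all loads follows from smoothness beyond the table. -/
theorem smoothAt_all (hf : TaxLPFeasible i Ψ g) (hΨ : 1 ≤ Ψ) (h0 : i = 0 → Ψ ≤ 1)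
    (ht : ∀ n ≥ taxK, ∀ m : ℕ, (n : ℝ) ^ (i + 1) ≤ Ψ * (m : ℝ) ^ (i + 1)
      - m * (tailCoeff i * ((n : ℝ) + 1) ^ i) + n * (tailCoeff i * (n : ℝ) ^ i)) (n m : ℕ) :
    SmoothAt i Ψ (taxedMonomial i g) n m := by
  rcases lt_or_ge n taxK with hn | hn
  · rcases le_or_gt m ((taxK + 1) ^ 2) with hm | hm
    · exact hf.smoothAt hn hm
    -- The row `m = n + 1` bounds the tax at `n + 1` by `Ψ (n + 1) ^ (i + 1)`. For `i ≥ 1` this is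
    -- at most `Ψ m ^ i` once `m > (K + 1) ^ 2`, which explains the range of `m` in the program.
    -- Then the terms with `m` are harmless and the row `m = 0` (`hl`) suffices.
    have hb := SmoothAt.upper_bound (m := n + 1) hΨ
      (fun k hk => hf.smoothAt hk
        ((Nat.succ_le_succ hn.le).trans (Nat.le_self_pow two_ne_zero _))) hn (by omega)
    have hl := hf.le_of_lt hn
    have hg : taxedMonomial i g (n + 1) ≤ Ψ * (m : ℝ) ^ i := by
      push_cast at hb
      rcases Nat.eq_zero_or_pos i with rfl | hi
      · have := h0 rfl
        have : Ψ = 1 := le_antisymm this hΨ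
        subst this
        simp at hb ⊢
        linarith
      · have h1 : ((n : ℝ) + 1) ^ (i + 1) ≤ (m : ℝ) ^ i := by
          have : (n + 1) ^ (i + 1) ≤ m ^ i := by
            calc (n + 1) ^ (i + 1) ≤ (taxK + 1) ^ (i + 1) := Nat.pow_le_pow_left (by omega) _
              _ ≤ (taxK + 1) ^ (2 * i) := Nat.pow_le_pow_right (by omega) (by omega)
              _ = ((taxK + 1) ^ 2) ^ i := by rw [pow_mul]
              _ ≤ m ^ i := Nat.pow_le_pow_left hm.le _
          exact_mod_cast this
        have h2 : (0 : ℝ) ≤ (n : ℝ) ^ (i + 1) := by positivity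
        have h3 := mul_le_mul_of_nonneg_left h1 (by linarith : 0 ≤ Ψ)
        linarith
    have h4 := mul_le_mul_of_nonneg_left hg (m.cast_nonneg : (0 : ℝ) ≤ m)
    unfold SmoothAt
    have e : Ψ * (m : ℝ) ^ (i + 1) = m * (Ψ * (m : ℝ) ^ i) := by ring
    linarith
  · have h1 := ht n hn m
    unfold SmoothAt
    rw [taxedMonomial_of_lt (by omega : taxK < n + 1)]
    push_cast
    have h2 : tailCoeff i * (n : ℝ) ^ i ≤ taxedMonomial i g n := by
      rcases hn.eq_or_lt with rfl | hn
      · exact hf.tail'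
      · rw [taxedMonomial_of_lt hn]
    have := mul_le_mul_of_nonneg_left h2 (n.cast_nonneg : (0 : ℝ) ≤ n)
    linarith

theorem tailCoeff_nonneg {i : ℕ} (hi : 0 ≤ refLam i) : 0 ≤ tailCoeff i := by
  unfold tailCoeff; positivity

/-- The inequality of one resource with a monomial cost function in the taxed game. -/
theorem overlap (hf : TaxLPFeasible i Ψ g) (hΨ : 1 ≤ Ψ) (h0 : i = 0 → Ψ ≤ 1)
    (hc : 0 ≤ tailCoeff i)
    (ht : ∀ n ≥ taxK, ∀ m : ℕ, (n : ℝ) ^ (i + 1) ≤ Ψ * (m : ℝ) ^ (i + 1)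
      - m * (tailCoeff i * ((n : ℝ) + 1) ^ i) + n * (tailCoeff i * (n : ℝ) ^ i))
    {n m k : ℕ} (hkn : k ≤ n) (hkm : k ≤ m) :
    ((m : ℝ) - k) * taxedMonomial i g (n + 1) + k * taxedMonomial i g n
      - n * taxedMonomial i g n + (n : ℝ) ^ (i + 1) ≤ Ψ * (m : ℝ) ^ (i + 1) := by
  -- The tail starts at `K + 1` here: the table value at `K` may exceed `ν_i K ^ i`.
  refine SmoothAt.overlap hΨ (hf.smoothAt_all hΨ h0 ht) (N := taxK + 1) (fun n hn m => ?_) hkn hkm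
  rw [taxedMonomial_of_lt (by omega)]
  have h1 := ht n (by omega) m
  have h2 : (n : ℝ) ^ i ≤ ((n : ℝ) + 1) ^ i := by gcongr; linarith
  have h3 := mul_le_mul_of_nonneg_left (mul_le_mul_of_nonneg_left h2 hc)
    (m.cast_nonneg : (0 : ℝ) ≤ m)
  linarith

theorem taxedMonomial_nonneg (hf : TaxLPFeasible i Ψ g) (hc : 0 ≤ tailCoeff i) (n : ℕ) :
    0 ≤ taxedMonomial i g n := by
  unfold taxedMonomial
  split
  · exact hf.nonneg _
  · positivity

end TaxLPFeasible

/-! ### Summation over resources and monomials. -/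

namespace CongestionGame

variable {P E : Type*} [Fintype P] [DecidableEq E]

theorem load_update [DecidableEq P] (s : P → Finset E) (u : P) {a : Finset E} {e : E} (he : e ∈ a) :
    load (Function.update s u a) e = if e ∈ s u then load s e else load s e + 1 := by
  have h : (Finset.univ.filter fun v => e ∈ Function.update s u a v)
      = insert u (Finset.univ.filter fun v => e ∈ s v) := by
    ext v
    by_cases hv : v = u
    · subst hv; simp [he]
    · simp [hv]
  unfold load
  rw [h]
  split_ifs with hu
  · rw [Finset.insert_eq_of_mem (by simpa using hu)]
  · rw [Finset.card_insert_of_notMem (by simpa using hu)]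

/-- The number of players that use `e` in both states. -/
def commonLoad (s t : P → Finset E) (e : E) : ℕ :=
  (Finset.univ.filter fun u => e ∈ t u ∧ e ∈ s u).card

theorem commonLoad_le_left (s t : P → Finset E) (e : E) : commonLoad s t e ≤ load s e :=
  Finset.card_le_card fun u => by simp

theorem commonLoad_le_right (s t : P → Finset E) (e : E) : commonLoad s t e ≤ load t e :=
  Finset.card_le_card fun u => by simp +contextual

variable [Fintype E]

theorem sum_sum_mem (s : P → Finset E) (F : P → E → ℝ) :
    ∑ u, ∑ e ∈ s u, F u e = ∑ e, ∑ u with e ∈ s u, F u e := by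
  rw [Finset.sum_comm' (t' := Finset.univ)
    (s' := fun e => Finset.univ.filter fun u => e ∈ s u) (by simp)]

theorem sum_cost (G : CongestionGame P E) (s : P → Finset E) :
    ∑ u, G.toStrategicGame.cost s u = ∑ e, (load s e : ℝ) * G.cost e (load s e) := by
  simp only [toStrategicGame]
  rw [sum_sum_mem s fun _ e => G.cost e (load s e)]
  simp [load]

/-- A deviating player who already uses `e` leaves its load unchanged; any other player who moves to
`e` raises it by one. -/
theorem sum_deviation_cost [DecidableEq P] (G : CongestionGame P E) (s t : P → Finset E) :
    ∑ u, G.toStrategicGame.cost (Function.update s u (t u)) u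
      = ∑ e, (((load t e : ℝ) - commonLoad s t e) * G.cost e (load s e + 1)
        + commonLoad s t e * G.cost e (load s e)) := by
  have h1 : ∀ u, G.toStrategicGame.cost (Function.update s u (t u)) u
      = ∑ e ∈ t u, if e ∈ s u then G.cost e (load s e) else G.cost e (load s e + 1) := by
    intro u
    simp only [toStrategicGame, Function.update_self]
    refine Finset.sum_congr rfl fun e he => ?_
    rw [load_update s u he]
    split_ifs <;> rfl
  rw [Finset.sum_congr rfl fun u _ => h1 u, sum_sum_mem t fun u e =>
    if e ∈ s u then G.cost e (load s e) else G.cost e (load s e + 1)]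
  refine Finset.sum_congr rfl fun e _ => ?_
  rw [Finset.sum_ite, Finset.sum_const, Finset.sum_const, Finset.filter_filter,
    Finset.filter_filter]
  have h2 := Finset.card_filter_add_card_filter_not (s := Finset.univ.filter fun u => e ∈ t u)
    (fun u => e ∈ s u)
  rw [Finset.filter_filter, Finset.filter_filter] at h2
  have h3 : ((Finset.univ.filter fun u => e ∈ t u ∧ e ∉ s u).card : ℝ)
      = load t e - commonLoad s t e := by
    rw [eq_sub_iff_add_eq']
    exact_mod_cast h2
  rw [nsmul_eq_mul, nsmul_eq_mul, h3]
  unfold commonLoad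
  ring

/-- A resource-wise inequality gives smoothness. -/
theorem isSmooth_of_resource [DecidableEq P] (G G' : CongestionGame P E) {Ψ : ℝ}
    (h : ∀ e, ∀ n m k : ℕ, k ≤ n → k ≤ m →
      ((m : ℝ) - k) * G'.cost e (n + 1) + k * G'.cost e n - n * G'.cost e n + n * G.cost e n
        ≤ Ψ * (m * G.cost e m)) :
    G'.toStrategicGame.IsSmooth Ψ 0 G.socialCost := by
  intro s t _ _
  rw [sum_deviation_cost, sum_cost, socialCost, socialCost, sum_cost, sum_cost, sub_zero,
    one_mul, Finset.mul_sum, ← Finset.sum_sub_distrib, ← Finset.sum_add_distrib]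
  exact Finset.sum_le_sum fun e _ =>
    h e _ _ _ (commonLoad_le_left s t e) (commonLoad_le_right s t e)

end CongestionGame

theorem StrategicGame.IsSmooth.le_of_isPureNash {P A : Type*} [Fintype P] [DecidableEq P]
    {Γ : StrategicGame P A} {Ψ : ℝ} {h : (P → A) → ℝ} (hs : Γ.IsSmooth Ψ 0 h) {s t : P → A}
    (hn : Γ.IsPureNash s) (ht : Γ.IsState t) : h s ≤ Ψ * h t := by
  have h1 := hs s t hn.1 ht
  have h2 := Finset.sum_le_sum fun u (_ : u ∈ Finset.univ) => hn.2 u (t u) (ht u)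
  linarith

theorem taxedCost_eq_sum {d : ℕ} (g : ℕ → Fin (taxK + 1) → ℝ) {f : Polynomial ℝ}
    (hf : f.natDegree ≤ d) (n : ℕ) :
    taxedCost g f n = ∑ i ∈ Finset.range (d + 1), f.coeff i * taxedMonomial i (g i) n :=
  f.sum_over_range' (by simp) (d + 1) (by omega)

/-- Monomial-wise inequalities give the inequality of one resource. -/
theorem taxedCost_overlap {d : ℕ} {Ψ : ℝ} (g : ℕ → Fin (taxK + 1) → ℝ) {f : Polynomial ℝ}
    (hf : f.natDegree ≤ d) (hf0 : ∀ i, 0 ≤ f.coeff i) {n m k : ℕ}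
    (h : ∀ i ≤ d, ((m : ℝ) - k) * taxedMonomial i (g i) (n + 1) + k * taxedMonomial i (g i) n
      - n * taxedMonomial i (g i) n + (n : ℝ) ^ (i + 1) ≤ Ψ * (m : ℝ) ^ (i + 1)) :
    ((m : ℝ) - k) * taxedCost g f (n + 1) + k * taxedCost g f n - n * taxedCost g f n
      + n * f.eval (n : ℝ) ≤ Ψ * (m * f.eval (m : ℝ)) := by
  rw [taxedCost_eq_sum g hf, taxedCost_eq_sum g hf, f.eval_eq_sum_range' (by omega : _ < d + 1),
    f.eval_eq_sum_range' (by omega : _ < d + 1)]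
  simp only [Finset.mul_sum]
  rw [← Finset.sum_add_distrib, ← Finset.sum_sub_distrib, ← Finset.sum_add_distrib]
  refine Finset.sum_le_sum fun i hi => ?_
  have h1 := mul_le_mul_of_nonneg_left (h i (by simpa [Nat.lt_succ_iff] using hi)) (hf0 i)
  ring_nf at h1 ⊢
  exact h1

/-! ### The largest tax, existence of optima and their arithmetic form. -/

theorem one_mem_Icc_taxRange : (Finset.Icc 1 ((taxK + 1) ^ 2)).Nonempty :=
  Finset.nonempty_Icc.2 (Nat.one_le_pow _ _ (Nat.succ_pos _))

/-- The largest tax that satisfies the smoothness constraints for a given objective value. -/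
noncomputable def maxTax (i : ℕ) (Ψ : ℝ) : ℕ → ℝ
  | 0 => 0
  | n + 1 => (Finset.Icc 1 ((taxK + 1) ^ 2)).inf' one_mem_Icc_taxRange fun m =>
      (Ψ * (m : ℝ) ^ (i + 1) + n * maxTax i Ψ n - (n : ℝ) ^ (i + 1)) / m

theorem le_maxTax_succ {i n : ℕ} {Ψ x : ℝ} :
    x ≤ maxTax i Ψ (n + 1) ↔ ∀ m : ℕ, m ∈ Finset.Icc 1 ((taxK + 1) ^ 2) →
      (n : ℝ) ^ (i + 1) ≤ Ψ * (m : ℝ) ^ (i + 1) - m * x + n * maxTax i Ψ n := by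
  rw [maxTax, Finset.le_inf'_iff]
  refine forall₂_congr fun m hm => ?_
  have : (0 : ℝ) < m := by exact_mod_cast (Finset.mem_Icc.1 hm).1
  rw [le_div_iff₀ this]
  constructor <;> intro h <;> linarith

theorem continuous_maxTax (i n : ℕ) : Continuous fun Ψ => maxTax i Ψ n := by
  induction n with
  | zero => exact continuous_const
  | succ n ih =>
    simp only [maxTax]
    refine Continuous.finset_inf'_apply _ fun m _ => ?_
    fun_prop

/-- The minimum is attained on one affine branch, so `a` and `b` depend on `Ψ`. The positive slope
is needed to solve a tight constraint for `Ψ`. -/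
theorem exists_maxTax_eq (i : ℕ) (Ψ : ℝ) (n : ℕ) :
    ∃ a b : ℚ, 0 ≤ b ∧ (n ≠ 0 → 0 < b) ∧ maxTax i Ψ n = a + b * Ψ := by
  induction n with
  | zero => exact ⟨0, 0, le_rfl, by simp, by simp [maxTax]⟩
  | succ n ih =>
    obtain ⟨a, b, hb, -, e⟩ := ih
    obtain ⟨m, hm, h⟩ := Finset.exists_mem_eq_inf' one_mem_Icc_taxRange fun m : ℕ =>
      (Ψ * (m : ℝ) ^ (i + 1) + n * maxTax i Ψ n - (n : ℝ) ^ (i + 1)) / m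
    have hm' : 0 < m := (Finset.mem_Icc.1 hm).1
    have : (0 : ℚ) < m := by exact_mod_cast hm'
    have hb' : (0 : ℚ) < (m ^ (i + 1) + n * b) / m := by positivity
    refine ⟨(n * a - n ^ (i + 1)) / m, (m ^ (i + 1) + n * b) / m, hb'.le, fun _ => hb', ?_⟩
    rw [maxTax, h, e]
    push_cast
    ring

/-- A larger tax at `n` only relaxes the upper bound on the tax at `n + 1`, so the greedy choice
dominates every feasible tax. -/
theorem TaxLPFeasible.le_maxTax {i : ℕ} {Ψ : ℝ} {g : Fin (taxK + 1) → ℝ}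
    (hf : TaxLPFeasible i Ψ g) {n : ℕ} (hn : n < taxK) :
    taxedMonomial i g (n + 1) ≤ maxTax i Ψ (n + 1) := by
  induction n with
  | zero =>
    refine le_maxTax_succ.2 fun m hm => ?_
    have := hf.smoothAt hn (Finset.mem_Icc.1 hm).2
    simpa [SmoothAt] using this
  | succ n ih =>
    refine le_maxTax_succ.2 fun m hm => ?_
    have h1 := hf.smoothAt hn (Finset.mem_Icc.1 hm).2
    have h2 := mul_le_mul_of_nonneg_left (ih (by omega)) ((n + 1).cast_nonneg : (0 : ℝ) ≤ _)
    unfold SmoothAt at h1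
    linarith

/-- The constraints that remain when the tax is maximal. -/
def MaxTaxFeasible (i : ℕ) (Ψ : ℝ) : Prop :=
  (∀ n < taxK, n ≠ 0 → (n : ℝ) ^ i ≤ maxTax i Ψ n) ∧
    tailCoeff i * (taxK : ℝ) ^ i ≤ maxTax i Ψ taxK

theorem TaxLPFeasible.maxTaxFeasible {i : ℕ} {Ψ : ℝ} {g : Fin (taxK + 1) → ℝ}
    (hf : TaxLPFeasible i Ψ g) : MaxTaxFeasible i Ψ := by
  constructor
  · intro n hn h0
    obtain ⟨k, rfl⟩ := Nat.exists_eq_succ_of_ne_zero h0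
    refine le_trans ?_ (hf.le_maxTax (n := k) (by omega))
    have h1 := hf.le_of_lt hn
    rw [pow_succ'] at h1
    exact le_of_mul_le_mul_left h1 (by positivity)
  · exact hf.tail'.trans (hf.le_maxTax (n := taxK - 1) (Nat.sub_lt taxK_pos one_pos))

theorem MaxTaxFeasible.taxLPFeasible {i : ℕ} {Ψ : ℝ} (hc : 0 ≤ tailCoeff i)
    (h : MaxTaxFeasible i Ψ) : TaxLPFeasible i Ψ fun n => maxTax i Ψ n where
  smooth n m hm := by
    rcases Nat.eq_zero_or_pos m with rfl | hm0
    · rcases Nat.eq_zero_or_pos (n : ℕ) with h0 | h0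
      · simp [h0]
      · have h1 := h.1 n n.2 h0.ne'
        have h2 := mul_le_mul_of_nonneg_left h1 ((n : ℕ).cast_nonneg : (0 : ℝ) ≤ _)
        simp only [Fin.val_castSucc]
        rw [pow_succ']
        simpa using h2
    · exact le_maxTax_succ.1 le_rfl m (Finset.mem_Icc.2 ⟨hm0, hm⟩)
  tail := h.2
  nonneg n := by
    rcases Nat.eq_zero_or_pos (n : ℕ) with h0 | h0
    · simp [h0, maxTax]
    · rcases (Nat.lt_succ_iff.1 n.2).eq_or_lt with h1 | h1
      · rw [h1]; exact le_trans (by positivity) h.2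
      · exact le_trans (by positivity) (h.1 n h1 h0.ne')

theorem taxLPValues_eq {i : ℕ} (hc : 0 ≤ tailCoeff i) :
    taxLPValues i = {Ψ | MaxTaxFeasible i Ψ} :=
  Set.ext fun _ => ⟨fun ⟨_, h⟩ => h.maxTaxFeasible, fun h => ⟨_, h.taxLPFeasible hc⟩⟩

theorem isClosed_taxLPValues {i : ℕ} (hc : 0 ≤ tailCoeff i) : IsClosed (taxLPValues i) := by
  rw [taxLPValues_eq hc]
  simp only [MaxTaxFeasible, Set.ofPred_and, Set.ofPred_forall]
  refine IsClosed.inter ?_ (isClosed_le continuous_const (continuous_maxTax i _))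
  exact isClosed_iInter fun n => isClosed_iInter fun _ => isClosed_iInter fun _ =>
    isClosed_le continuous_const (continuous_maxTax i n)

theorem TaxLPFeasible.nonneg_objective {i : ℕ} {Ψ : ℝ} {g : Fin (taxK + 1) → ℝ}
    (hf : TaxLPFeasible i Ψ g) : 0 ≤ Ψ := by
  have h := hf.smoothAt (n := 0) (m := 1) taxK_pos (Nat.one_le_pow _ _ (Nat.succ_pos _))
  have h1 := hf.nonneg ⟨1, by norm_num [taxK]⟩
  simp only [SmoothAt, zero_add] at h
  rw [taxedMonomial_of_le (n := 1) (by norm_num [taxK])] at h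
  simp at h
  linarith

theorem isLeast_taxLPOpt {i : ℕ} (hc : 0 ≤ tailCoeff i) (hne : (taxLPValues i).Nonempty) :
    IsLeast (taxLPValues i) (taxLPOpt i) :=
  (isClosed_taxLPValues hc).isLeast_csInf hne ⟨0, fun _ ⟨_, h⟩ => h.nonneg_objective⟩

/-- At the optimum one of the constraints is tight. -/
theorem exists_tight {i : ℕ} {Ψ : ℝ} (hc : 0 ≤ tailCoeff i) (hl : IsLeast (taxLPValues i) Ψ) :
    (∃ n : ℕ, n ≠ 0 ∧ maxTax i Ψ n = (n : ℝ) ^ i) ∨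
      maxTax i Ψ taxK = tailCoeff i * (taxK : ℝ) ^ i := by
  by_contra! hcon
  obtain ⟨hmem, hlow⟩ := hl
  rw [taxLPValues_eq hc] at hmem hlow
  obtain ⟨h1, h2⟩ := hmem
  have e1 : ∀ n ∈ Finset.range taxK, ∀ᶠ x in nhds Ψ, n ≠ 0 → (n : ℝ) ^ i < maxTax i x n := by
    intro n hn
    by_cases h0 : n = 0
    · simp [h0]
    · have := lt_of_le_of_ne (h1 n (Finset.mem_range.1 hn) h0) (hcon.1 n h0).symm
      filter_upwards [(continuous_maxTax i n).continuousAt.eventually (lt_mem_nhds this)]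
        with x hx _ using hx
  have e2 := (continuous_maxTax i taxK).continuousAt.eventually
    (lt_mem_nhds (lt_of_le_of_ne h2 hcon.2.symm))
  have e3 := ((Finset.eventually_all _).2 e1).and e2
  -- Finitely many strict inequalities survive a small decrease of `Ψ`, which contradicts
  -- minimality.
  obtain ⟨x, hx, hxΨ⟩ := ((e3.filter_mono nhdsWithin_le_nhds).and
    (self_mem_nhdsWithin : Set.Iio Ψ ∈ nhdsWithin Ψ (Set.Iio Ψ))).exists
  have : MaxTaxFeasible i x :=
    ⟨fun n hn h0 => (hx.1 n (Finset.mem_range.2 hn) h0).le, hx.2.le⟩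
  exact absurd (hlow this) (not_le.2 hxΨ)

/-- The optimal value is an affine function of the tail coefficient, with rational coefficients. -/
theorem exists_eq_add_mul_tailCoeff {i : ℕ} {Ψ : ℝ} (hc : 0 ≤ tailCoeff i)
    (hl : IsLeast (taxLPValues i) Ψ) : ∃ a b : ℚ, Ψ = a + b * tailCoeff i := by
  rcases exists_tight hc hl with ⟨n, hn, h⟩ | h
  · obtain ⟨a, b, -, hb, e⟩ := exists_maxTax_eq i Ψ n
    have hb : (0 : ℝ) < b := by exact_mod_cast hb hn
    refine ⟨(n ^ i - a) / b, 0, ?_⟩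
    rw [h] at e
    push_cast
    rw [zero_mul, add_zero, eq_div_iff hb.ne']
    linarith
  · obtain ⟨a, b, -, hb, e⟩ := exists_maxTax_eq i Ψ taxK
    have hb : (0 : ℝ) < b := by exact_mod_cast hb taxK_pos.ne'
    refine ⟨-a / b, taxK ^ i / b, ?_⟩
    rw [h] at e
    push_cast
    field_simp
    linarith

theorem exists_maxTax_eq_add_mul_tailCoeff {i : ℕ} {Ψ : ℝ} (hc : 0 ≤ tailCoeff i)
    (hl : IsLeast (taxLPValues i) Ψ) (n : ℕ) :
    ∃ a b : ℚ, maxTax i Ψ n = a + b * tailCoeff i := by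
  obtain ⟨a, b, -, -, e⟩ := exists_maxTax_eq i Ψ n
  obtain ⟨a', b', e'⟩ := exists_eq_add_mul_tailCoeff hc hl
  refine ⟨a + b * a', b * b', ?_⟩
  rw [e]
  nth_rewrite 1 [e']
  push_cast
  ring

/-! ### Computation in a constant number of steps. -/

namespace RealProg

/-- The number `c` can be computed: for each register `r` a program writes `c` into `r` within a
fixed number of steps and leaves the registers below `r` unchanged. -/
def Loads (c : ℝ) : Prop :=
  ∀ r : ℕ, ∃ (p : RealProg) (t : ℕ), ∀ σ : ℕ → ℝ, ∃ τ, p.Exec σ t τ ∧ τ r = c ∧ ∀ j < r, τ j = σ j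

theorem loads_int (z : ℤ) : Loads z := fun r =>
  ⟨.const r z, 1, fun σ => ⟨_, .const σ r z, by simp, fun j hj => by simp [hj.ne]⟩⟩

theorem Loads.binary {c c' x : ℝ} (hc : Loads c) (hc' : Loads c') (op : ℕ → RealProg)
    (hop : ∀ r (σ : ℕ → ℝ), σ r = c → σ (r + 1) = c' →
      (op r).Exec σ 1 (Function.update σ r x)) : Loads x := by
  intro r
  obtain ⟨p, t, hp⟩ := hc r
  obtain ⟨p', t', hp'⟩ := hc' (r + 1)
  refine ⟨.seq p (.seq p' (op r)), t + (t' + 1), fun σ => ?_⟩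
  obtain ⟨τ, h1, h2, h3⟩ := hp σ
  obtain ⟨τ', h1', h2', h3'⟩ := hp' τ
  refine ⟨_, .seq h1 (.seq h1' (hop r τ' ?_ h2')), by simp, fun j hj => ?_⟩
  · rw [h3' r (by omega), h2]
  · rw [Function.update_of_ne hj.ne, h3' j (by omega), h3 j hj]

theorem Loads.add {c c' : ℝ} (hc : Loads c) (hc' : Loads c') : Loads (c + c') :=
  hc.binary hc' (fun r => .add r r (r + 1)) fun r σ h h' => h ▸ h' ▸ .add σ r r (r + 1)

theorem Loads.mul {c c' : ℝ} (hc : Loads c) (hc' : Loads c') : Loads (c * c') :=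
  hc.binary hc' (fun r => .mul r r (r + 1)) fun r σ h h' => h ▸ h' ▸ .mul σ r r (r + 1)

theorem Loads.div {c c' : ℝ} (hc : Loads c) (hc' : Loads c') (h0 : c' ≠ 0) : Loads (c / c') :=
  hc.binary hc' (fun r => .div r r (r + 1)) fun r σ h h' => by
    subst h; subst h'; exact .div σ r r (r + 1) h0

theorem loads_rat (q : ℚ) : Loads q := by
  have h : ((q.num : ℤ) : ℝ) / ((q.den : ℤ) : ℝ) = q := by
    rw [Int.cast_natCast]; exact_mod_cast q.num_div_den
  rw [← h]
  exact (loads_int _).div (loads_int _) (by exact_mod_cast q.den_nz)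

theorem Loads.root {c : ℝ} (hc : Loads c) {k : ℕ} (hk : 1 ≤ k) (h0 : 0 ≤ c) :
    Loads (c ^ (1 / (k : ℝ))) := by
  intro r
  obtain ⟨p, t, hp⟩ := hc r
  refine ⟨.seq p (.root k r r), t + 1, fun σ => ?_⟩
  obtain ⟨τ, h1, h2, h3⟩ := hp σ
  refine ⟨_, .seq h1 (.root τ k r r hk (h2 ▸ h0)), by simp [h2], fun j hj => ?_⟩
  rw [Function.update_of_ne hj.ne, h3 j hj]

/-- The register `j` can be copied to the register `r`, with `S` as scratch register. -/
theorem exists_copy (S r j : ℕ) : ∃ p : RealProg, ∀ σ : ℕ → ℝ, ∃ τ,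
    p.Exec σ 2 τ ∧ (j ≠ S → τ r = σ j) ∧ ∀ l, l ≠ S → l ≠ r → τ l = σ l := by
  refine ⟨.seq (.const S 0) (.add r j S), fun σ =>
    ⟨_, .seq (.const σ S 0) (.add _ r j S), fun h => ?_, fun l h1 h2 => ?_⟩⟩
  · simp [h]
  · simp [h1, h2]

/-- The first `d` registers can be copied to the registers from `B` on. -/
theorem exists_copy_block (B d : ℕ) (hB : d ≤ B) : ∃ (p : RealProg) (t : ℕ), ∀ σ : ℕ → ℝ, ∃ τ,
    p.Exec σ t τ ∧ (∀ i < d, τ (B + i) = σ i) ∧ ∀ l < B, τ l = σ l := by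
  suffices H : ∀ k ≤ d, ∃ (p : RealProg) (t : ℕ), ∀ σ : ℕ → ℝ, ∃ τ,
      p.Exec σ t τ ∧ (∀ i < k, τ (B + i) = σ i) ∧ ∀ l < B, τ l = σ l from H d le_rfl
  intro k
  induction k with
  | zero =>
    intro _
    exact ⟨.const B 0, 1, fun σ => ⟨_, .const σ B 0, by simp, fun l hl => by simp [hl.ne]⟩⟩
  | succ k ih =>
    intro hk
    obtain ⟨p, t, hp⟩ := ih (by omega)
    obtain ⟨q, hq⟩ := exists_copy (B + d) (B + k) k
    refine ⟨.seq p q, t + 2, fun σ => ?_⟩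
    obtain ⟨τ, h1, h2, h3⟩ := hp σ
    obtain ⟨ρ, h4, h5, h6⟩ := hq τ
    refine ⟨ρ, .seq h1 h4, fun i hi => ?_, fun l hl => ?_⟩
    · rcases Nat.lt_succ_iff_lt_or_eq.1 hi with hi | rfl
      · rw [h6 _ (by omega) (by omega), h2 i hi]
      · rw [h5 (by omega), h3 _ (by omega)]
    · rw [h6 _ (by omega) (by omega), h3 l hl]

/-- A linear combination of the registers `B, …, B + d - 1` with computable coefficients. -/
theorem exists_linear_combination (B d S : ℕ) (hS : B + d ≤ S) (c : ℕ → ℝ)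
    (hc : ∀ i < d, Loads (c i)) : ∃ (p : RealProg) (t : ℕ), ∀ σ : ℕ → ℝ, ∃ τ,
    p.Exec σ t τ ∧ τ S = ∑ i ∈ Finset.range d, σ (B + i) * c i ∧ ∀ l < S, τ l = σ l := by
  suffices H : ∀ k ≤ d, ∃ (p : RealProg) (t : ℕ), ∀ σ : ℕ → ℝ, ∃ τ,
      p.Exec σ t τ ∧ τ S = ∑ i ∈ Finset.range k, σ (B + i) * c i ∧ ∀ l < S, τ l = σ l from
    H d le_rfl
  intro k
  induction k with
  | zero =>
    intro _
    exact ⟨.const S 0, 1, fun σ => ⟨_, .const σ S 0, by simp, fun l hl => by simp [hl.ne]⟩⟩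
  | succ k ih =>
    intro hk
    obtain ⟨p, t, hp⟩ := ih (by omega)
    obtain ⟨q, t', hq⟩ := hc k (by omega) (S + 1)
    refine ⟨.seq p (.seq q (.seq (.mul (S + 1) (B + k) (S + 1)) (.add S S (S + 1)))),
      t + (t' + (1 + 1)), fun σ => ?_⟩
    obtain ⟨τ, h1, h2, h3⟩ := hp σ
    obtain ⟨ρ, h4, h5, h6⟩ := hq τ
    refine ⟨_, .seq h1 (.seq h4 (.seq (.mul ρ _ _ _) (.add _ _ _ _))), ?_, fun l hl => ?_⟩
    · rw [Finset.sum_range_succ]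
      simp [h5, h6 S (by omega), h6 (B + k) (by omega), h2, h3 (B + k) (by omega)]
    · rw [Function.update_of_ne hl.ne, Function.update_of_ne (by omega), h6 l (by omega), h3 l hl]

/-- Linear forms with computable coefficients in the first `d` registers can be computed in a fixed
number of steps. -/
theorem exists_linear_map (R d : ℕ) (hd : d ≤ R) (c : ℕ → ℕ → ℝ)
    (hc : ∀ r < R, ∀ i < d, Loads (c r i)) : ∃ (p : RealProg) (t : ℕ), ∀ σ : ℕ → ℝ, ∃ τ,
    p.Exec σ t τ ∧ ∀ r < R, τ r = ∑ i ∈ Finset.range d, σ i * c r i := by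
  suffices H : ∀ k ≤ R, ∃ (p : RealProg) (t : ℕ), ∀ σ : ℕ → ℝ, ∃ τ, p.Exec σ t τ ∧
      (∀ r < k, τ r = ∑ i ∈ Finset.range d, σ i * c r i) ∧ ∀ i < d, τ (R + i) = σ i by
    obtain ⟨p, t, h⟩ := H R le_rfl
    exact ⟨p, t, fun σ => let ⟨τ, h1, h2, _⟩ := h σ; ⟨τ, h1, h2⟩⟩
  intro k
  induction k with
  | zero =>
    intro _
    -- The inputs occupy registers that the outputs overwrite, so they are first saved from register
    -- `R` on.
    obtain ⟨p, t, h⟩ := exists_copy_block R d hd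
    exact ⟨p, t, fun σ => let ⟨τ, h1, h2, _⟩ := h σ; ⟨τ, h1, by simp, h2⟩⟩
  | succ k ih =>
    intro hk
    obtain ⟨p, t, hp⟩ := ih (by omega)
    obtain ⟨q, t', hq⟩ := exists_linear_combination R d (R + d) le_rfl (c k) (hc k (by omega))
    obtain ⟨q', hq'⟩ := exists_copy (R + d + 1) k (R + d)
    refine ⟨.seq p (.seq q q'), t + (t' + 2), fun σ => ?_⟩
    obtain ⟨τ, h1, h2, h3⟩ := hp σ
    obtain ⟨ρ, h4, h5, h6⟩ := hq τ
    obtain ⟨ρ', h7, h8, h9⟩ := hq' ρ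
    refine ⟨ρ', .seq h1 (.seq h4 h7), fun r hr => ?_, fun i hi => ?_⟩
    · rcases Nat.lt_succ_iff_lt_or_eq.1 hr with hr | rfl
      · rw [h9 _ (by omega) (by omega), h6 r (by omega), h2 r hr]
      · rw [h8 (by omega), h5]
        exact Finset.sum_congr rfl fun i hi => by rw [h3 i (Finset.mem_range.1 hi)]
    · rw [h9 _ (by omega) (by omega), h6 _ (by omega), h3 i hi]

end RealProg

theorem RealProg.exists_computesTaxedCost {d : ℕ} (g : ℕ → Fin (taxK + 1) → ℝ) (hd : d ≤ taxK)
    (hg : ∀ i ≤ d, ∀ n, RealProg.Loads (g i n)) (ht : ∀ i ≤ d, RealProg.Loads (tailCoeff i)) :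
    ∃ (T : ℕ) (p : RealProg), p.ComputesTaxedCost d g T := by
  obtain ⟨p, T, hp⟩ := RealProg.exists_linear_map (taxK + 1 + (d + 1)) (d + 1) (by omega)
    -- The matrix has the table in its rows up to `K` and below it a diagonal block with the tail
    -- coefficients.
    (fun r i => if r ≤ taxK then taxedMonomial i (g i) r
      else if r = taxK + 1 + i then tailCoeff i else 0) (by
      intro r _ i hi
      split_ifs with h1 h2
      · rw [taxedMonomial_of_le h1]; exact hg i (by omega) _
      · exact ht i (by omega)
      · exact_mod_cast RealProg.loads_int 0)
  refine ⟨T, p, fun f hf _ => ?_⟩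
  obtain ⟨τ, h1, h2⟩ := hp fun i => f.coeff i
  refine ⟨T, le_rfl, τ, h1, fun n => ?_⟩
  rw [taxedCost_eq_sum g hf, decodeCost]
  split_ifs with hn
  · rw [h2 n (by omega)]
    simp [hn]
  · refine Finset.sum_congr rfl fun i hi => ?_
    rw [h2 _ (by have := Finset.mem_range.1 hi; omega), taxedMonomial_of_lt (by omega),
      Finset.sum_eq_single i]
    · rw [if_neg (by omega), if_pos rfl, mul_assoc]
    · intro j _ hj
      rw [if_neg (by omega), if_neg (by omega), mul_zero]
    · intro h; exact absurd hi h

theorem RealProg.ComputesTaxedCost.mono {p : RealProg} {d : ℕ} {g : ℕ → Fin (taxK + 1) → ℝ}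
    {T T' : ℕ} (h : p.ComputesTaxedCost d g T) (hT : T ≤ T') : p.ComputesTaxedCost d g T' :=
  fun f hf hf0 => let ⟨t, ht, r⟩ := h f hf hf0; ⟨t, ht.trans hT, r⟩

/-! ### Smoothness of power taxes in the tail. -/

theorem tailCoeff_pow {i : ℕ} (hi : 0 ≤ refLam i) :
    tailCoeff i ^ (i + 1) = ((i : ℝ) + 1) * refLam i := by
  have h := Real.rpow_inv_natCast_pow (x := ((i : ℝ) + 1) * refLam i) (n := i + 1)
    (by positivity) (by omega)
  push_cast at h
  rw [tailCoeff, one_div, h]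

theorem le_tailCoeff {i : ℕ} {x : ℝ} (hi : 0 ≤ refLam i)
    (h : x ^ (i + 1) ≤ ((i : ℝ) + 1) * refLam i) : x ≤ tailCoeff i :=
  le_of_pow_le_pow_left₀ i.succ_ne_zero (TaxLPFeasible.tailCoeff_nonneg hi)
    ((tailCoeff_pow hi).symm ▸ h)

theorem tailCoeff_le {i : ℕ} {x : ℝ} (hi : 0 ≤ refLam i) (hx : 0 ≤ x)
    (h : ((i : ℝ) + 1) * refLam i ≤ x ^ (i + 1)) : tailCoeff i ≤ x :=
  le_of_pow_le_pow_left₀ i.succ_ne_zero hx ((tailCoeff_pow hi).symm ▸ h)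

/-- The smoothness condition for taxes of the form `c * n ^ i`. -/
theorem smooth_of_power_tax {i n : ℕ} {Ψ c w ρ : ℝ} (hΨ : 0 ≤ Ψ) (hw : 0 ≤ w) (hc : 0 ≤ c)
    (h1 : c * ρ ^ i ≤ Ψ * ((i : ℝ) + 1) * w ^ i) (h2 : Ψ * i * w ^ (i + 1) ≤ c - 1)
    (hn : (n : ℝ) + 1 ≤ ρ * n) (m : ℕ) :
    (n : ℝ) ^ (i + 1) ≤ Ψ * (m : ℝ) ^ (i + 1) - m * (c * ((n : ℝ) + 1) ^ i)
      + n * (c * (n : ℝ) ^ i) := by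
  have hn0 : (0 : ℝ) ≤ n := n.cast_nonneg
  have hm0 : (0 : ℝ) ≤ m := m.cast_nonneg
  -- AM-GM for `m` and `w n`. In the ideal case `c = ν`, `ν ^ (i + 1) = (i + 1) Ψ`, `ρ = 1`, `w = 1
  -- / ν`, the condition `h1` is an equality and `h2` reads `i / (i + 1) ≤ ν - 1`; this slack leaves
  -- room for roundings.
  have a1 := mul_le_mul_of_nonneg_left
    (weighted_am_gm hm0 (mul_nonneg hw hn0) i) hΨ
  have a2 : ((n : ℝ) + 1) ^ i ≤ ρ ^ i * (n : ℝ) ^ i := by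
    rw [← mul_pow]; gcongr
  have a3 : (m : ℝ) * (c * ((n : ℝ) + 1) ^ i) ≤ m * (c * (ρ ^ i * (n : ℝ) ^ i)) := by gcongr
  have a4 := mul_le_mul_of_nonneg_right h1 (by positivity : 0 ≤ (m : ℝ) * (n : ℝ) ^ i)
  have a5 := mul_le_mul_of_nonneg_right h2 (by positivity : 0 ≤ (n : ℝ) ^ (i + 1))
  rw [mul_pow, mul_pow] at a1
  have e1 : Ψ * (((i : ℝ) + 1) * m * (w ^ i * (n : ℝ) ^ i))
    = Ψ * ((i : ℝ) + 1) * w ^ i * (m * (n : ℝ) ^ i) := by ring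
  have e2 : Ψ * ((m : ℝ) ^ (i + 1) + i * (w ^ (i + 1) * (n : ℝ) ^ (i + 1)))
    = Ψ * (m : ℝ) ^ (i + 1) + Ψ * i * w ^ (i + 1) * (n : ℝ) ^ (i + 1) := by ring
  have e3 : (m : ℝ) * (c * (ρ ^ i * (n : ℝ) ^ i)) = c * ρ ^ i * (m * (n : ℝ) ^ i) := by ring
  have e4 : (n : ℝ) * (c * (n : ℝ) ^ i) = c * (n : ℝ) ^ (i + 1) := by ring
  rw [e1, e2] at a1
  rw [e3] at a3
  rw [e4]
  linarith

theorem smooth_of_tail {i : ℕ} {Ψ Ψ' lo hi w : ℝ} (hr : 0 ≤ refLam i)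
    (hlo : lo ^ (i + 1) ≤ ((i : ℝ) + 1) * refLam i) (hhi : 0 ≤ hi)
    (hhi' : ((i : ℝ) + 1) * refLam i ≤ hi ^ (i + 1)) (hΨ : 0 ≤ Ψ) (hw : 0 ≤ w)
    (h1 : hi * 1.001 ^ i ≤ Ψ * ((i : ℝ) + 1) * w ^ i) (h2 : Ψ * i * w ^ (i + 1) ≤ lo - 1)
    (hΨ' : Ψ ≤ Ψ') : ∀ n ≥ taxK, ∀ m : ℕ, (n : ℝ) ^ (i + 1) ≤ Ψ' * (m : ℝ) ^ (i + 1)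
      - m * (tailCoeff i * ((n : ℝ) + 1) ^ i) + n * (tailCoeff i * (n : ℝ) ^ i) := by
  intro n hn m
  have a1 := le_tailCoeff hr hlo
  have a2 := mul_le_mul_of_nonneg_right (tailCoeff_le hr hhi hhi')
    (by positivity : (0 : ℝ) ≤ 1.001 ^ i)
  have a3 : (1154 : ℝ) ≤ n := by exact_mod_cast hn
  -- `1.001` bounds `(n + 1) / n` for `n ≥ 1154`.
  have := smooth_of_power_tax (i := i) (n := n) (ρ := 1.001) hΨ hw
    (TaxLPFeasible.tailCoeff_nonneg hr) (a2.trans h1) (by linarith) (by linarith) m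
  have a4 := mul_le_mul_of_nonneg_right hΨ' (by positivity : (0 : ℝ) ≤ (m : ℝ) ^ (i + 1))
  linarith

/-! ### Numerical bounds for the optimal values. -/

/-- A tax that is given by a table first and by `C * n ^ i` afterwards. -/
def tableTax (l : List ℕ) (C i n : ℕ) : ℕ :=
  if n < l.length then l.getD n 0 else C * n ^ i

theorem tableTax_of_le {l : List ℕ} {C i n : ℕ} (h : l.length ≤ n) :
    tableTax l C i n = C * n ^ i := if_neg (not_lt.2 h)

/-- All data are integers over the common denominator `D`, so the table rows with `m < M` are
decidable. For `m ≥ M` the bound `hM` and the rows `m = 0` suffice; past the table,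
`smooth_of_power_tax` applies with `ρ = (L + 1) / L`, where `L` is the table length. -/
theorem mem_taxLPValues_of_table {i : ℕ} (l : List ℕ) (A C D M : ℕ) (hl0 : l ≠ [])
    (hl : l.length ≤ taxK) (hD : 0 < D)
    (hM : ∀ n < l.length, tableTax l C i (n + 1) ≤ A * M ^ i)
    (hT : ∀ n < l.length, ∀ m < M, D * n ^ (i + 1) + m * tableTax l C i (n + 1)
      ≤ A * m ^ (i + 1) + n * tableTax l C i n)
    (h0 : ∀ n < l.length, D * n ^ (i + 1) ≤ n * tableTax l C i n)
    (hc : tailCoeff i ≤ (C : ℝ) / D) {w : ℝ} (hw : 0 ≤ w)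
    (h1 : (C : ℝ) / D * (((l.length : ℝ) + 1) / l.length) ^ i
      ≤ (A : ℝ) / D * ((i : ℝ) + 1) * w ^ i)
    (h2 : (A : ℝ) / D * i * w ^ (i + 1) ≤ (C : ℝ) / D - 1) :
    (A : ℝ) / D ∈ taxLPValues i := by
  have hD' : (0 : ℝ) < D := by exact_mod_cast hD
  refine ⟨fun n => (tableTax l C i n : ℝ) / D, fun n m _ => ?_, ?_, fun n => by positivity⟩
  · simp only [Fin.val_succ, Fin.val_castSucc]
    generalize (n : ℕ) = n
    rcases lt_or_ge n l.length with hn | hn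
    · have h : D * n ^ (i + 1) + m * tableTax l C i (n + 1)
          ≤ A * m ^ (i + 1) + n * tableTax l C i n := by
        rcases lt_or_ge m M with hm | hm
        · exact hT n hn m hm
        · have a1 : m * tableTax l C i (n + 1) ≤ m * (A * m ^ i) :=
            Nat.mul_le_mul_left _ ((hM n hn).trans (by gcongr))
          have a2 := h0 n hn
          have e : m * (A * m ^ i) = A * m ^ (i + 1) := by ring
          omega
      have h' : (D : ℝ) * (n : ℝ) ^ (i + 1) + m * tableTax l C i (n + 1)
          ≤ A * (m : ℝ) ^ (i + 1) + n * tableTax l C i n := by exact_mod_cast h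
      refine le_of_mul_le_mul_left ?_ hD'
      field_simp
      linarith
    · rw [tableTax_of_le hn, tableTax_of_le (hn.trans n.le_succ)]
      have hl1 : (0 : ℝ) < l.length := by exact_mod_cast List.length_pos_iff.2 hl0
      have hn' : (l.length : ℝ) ≤ n := by exact_mod_cast hn
      have := smooth_of_power_tax (by positivity) hw (by positivity) h1 h2 (n := n) (by
        rw [div_mul_eq_mul_div, le_div_iff₀ hl1]; linarith) m
      push_cast
      convert this using 3 <;> ring
  · have : tailCoeff i * (taxK : ℝ) ^ i ≤ (C : ℝ) / D * (taxK : ℝ) ^ i := by gcongr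
    simp only [Fin.val_last]
    rw [tableTax_of_le hl]
    push_cast
    linarith [(by ring : (C : ℝ) * (taxK : ℝ) ^ i / D = (C : ℝ) / D * (taxK : ℝ) ^ i)]

theorem TaxLPFeasible.smooth_num {i : ℕ} {Ψ : ℝ} {g : Fin (taxK + 1) → ℝ}
    (hf : TaxLPFeasible i Ψ g) (n m : ℕ) (hn : n < 1000) (hm : m < 1000) :
    (n : ℝ) ^ (i + 1) ≤ Ψ * (m : ℝ) ^ (i + 1) - m * taxedMonomial i g (n + 1)
      + n * taxedMonomial i g n :=
  hf.smoothAt (hn.trans (by norm_num [taxK])) (hm.le.trans (by norm_num [taxK]))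

/-- A dual certificate: the chosen rows bound each tax through the previous one, and for `Ψ` below
the claimed value the bound at load 10 drops below what the last row, with `m = 0`, demands. The
other degrees work the same way, with longer chains from degree three on. -/
theorem lower_bound_one : 2.0115 ∈ lowerBounds (taxLPValues 1) := by
  rintro Ψ ⟨g, hf⟩
  by_contra! hΨ
  have h0 := hf.smooth_num 0 1 (by norm_num) (by norm_num)
  have h1 := hf.smooth_num 1 1 (by norm_num) (by norm_num)
  have h2 := hf.smooth_num 2 1 (by norm_num) (by norm_num)
  have h3 := hf.smooth_num 3 1 (by norm_num) (by norm_num)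
  have h4 := hf.smooth_num 4 2 (by norm_num) (by norm_num)
  have h5 := hf.smooth_num 5 2 (by norm_num) (by norm_num)
  have h6 := hf.smooth_num 6 2 (by norm_num) (by norm_num)
  have h7 := hf.smooth_num 7 2 (by norm_num) (by norm_num)
  have h8 := hf.smooth_num 8 2 (by norm_num) (by norm_num)
  have h9 := hf.smooth_num 9 2 (by norm_num) (by norm_num)
  have h10 := hf.smooth_num 10 0 (by norm_num) (by norm_num)
  norm_num at hΨ h0 h1 h2 h3 h4 h5 h6 h7 h8 h9 h10
  linarith

/-- The table follows the greedy recursion of `maxTax` at `Ψ = 4025 / 2000`, rounded down, until the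
recursion allows the tax `2.1 n`, whose coefficient exceeds `ν_1`. -/
theorem upper_bound_one : 2.0125 ∈ taxLPValues 1 := by
  have h := mem_taxLPValues_of_table (i := 1)
    [0, 4025, 6050, 8125, 10400, 12850, 15175, 17575, 20416, 23851, 29264, 38653] 4025 4200 2000 14
    (by simp) (by norm_num [taxK]) (by norm_num) (by decide +kernel) (by decide +kernel)
    (by decide +kernel) (tailCoeff_le (by norm_num [refLam]) (by norm_num) (by norm_num [refLam]))
    (w := 0.65) (by norm_num) (by norm_num) (by norm_num)
  norm_num at h ⊢
  exact h

theorem smooth_of_tail_one {Ψ : ℝ} (hΨ : 2.0115 ≤ Ψ) :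
    ∀ n ≥ taxK, ∀ m : ℕ, (n : ℝ) ^ (1 + 1) ≤ Ψ * (m : ℝ) ^ (1 + 1)
      - m * (tailCoeff 1 * ((n : ℝ) + 1) ^ 1) + n * (tailCoeff 1 * (n : ℝ) ^ 1) :=
  smooth_of_tail (lo := 2.005) (hi := 2.006) (w := 0.6) (by norm_num [refLam])
    (by norm_num [refLam]) (by norm_num) (by norm_num [refLam]) (by norm_num) (by norm_num)
    (by norm_num) (by norm_num) hΨ

theorem lower_bound_two : 5.095 ∈ lowerBounds (taxLPValues 2) := by
  rintro Ψ ⟨g, hf⟩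
  by_contra! hΨ
  have h0 := hf.smooth_num 0 1 (by norm_num) (by norm_num)
  have h1 := hf.smooth_num 1 1 (by norm_num) (by norm_num)
  have h2 := hf.smooth_num 2 1 (by norm_num) (by norm_num)
  have h3 := hf.smooth_num 3 1 (by norm_num) (by norm_num)
  have h4 := hf.smooth_num 4 2 (by norm_num) (by norm_num)
  have h5 := hf.smooth_num 5 2 (by norm_num) (by norm_num)
  have h6 := hf.smooth_num 6 2 (by norm_num) (by norm_num)
  have h7 := hf.smooth_num 7 2 (by norm_num) (by norm_num)
  have h8 := hf.smooth_num 8 2 (by norm_num) (by norm_num)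
  have h9 := hf.smooth_num 9 2 (by norm_num) (by norm_num)
  have h10 := hf.smooth_num 10 0 (by norm_num) (by norm_num)
  norm_num at hΨ h0 h1 h2 h3 h4 h5 h6 h7 h8 h9 h10
  linarith

theorem upper_bound_two : 5.105 ∈ taxLPValues 2 := by
  have h := mem_taxLPValues_of_table (i := 2)
    [0, 5105, 9210, 15525, 24680, 37780, 52370, 69530, 92275, 121345, 166980, 249130, 409511] 5105 3000 1000 12
    (by simp) (by norm_num [taxK]) (by norm_num) (by decide +kernel) (by decide +kernel)
    (by decide +kernel) (tailCoeff_le (by norm_num [refLam]) (by norm_num) (by norm_num [refLam]))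
    (w := 0.53) (by norm_num) (by norm_num) (by norm_num)
  norm_num at h ⊢
  exact h

theorem smooth_of_tail_two {Ψ : ℝ} (hΨ : 5.095 ≤ Ψ) :
    ∀ n ≥ taxK, ∀ m : ℕ, (n : ℝ) ^ (2 + 1) ≤ Ψ * (m : ℝ) ^ (2 + 1)
      - m * (tailCoeff 2 * ((n : ℝ) + 1) ^ 2) + n * (tailCoeff 2 * (n : ℝ) ^ 2) :=
  smooth_of_tail (lo := 2.48) (hi := 2.49) (w := 0.45) (by norm_num [refLam])
    (by norm_num [refLam]) (by norm_num) (by norm_num [refLam]) (by norm_num) (by norm_num)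
    (by norm_num) (by norm_num) hΨ

theorem lower_bound_three : 15.545 ∈ lowerBounds (taxLPValues 3) := by
  rintro Ψ ⟨g, hf⟩
  by_contra! hΨ
  have h0 := hf.smooth_num 0 1 (by norm_num) (by norm_num)
  have h1 := hf.smooth_num 1 1 (by norm_num) (by norm_num)
  have h2 := hf.smooth_num 2 1 (by norm_num) (by norm_num)
  have h3 := hf.smooth_num 3 1 (by norm_num) (by norm_num)
  have h4 := hf.smooth_num 4 1 (by norm_num) (by norm_num)
  have h5 := hf.smooth_num 5 2 (by norm_num) (by norm_num)
  have h6 := hf.smooth_num 6 2 (by norm_num) (by norm_num)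
  have h7 := hf.smooth_num 7 2 (by norm_num) (by norm_num)
  have h8 := hf.smooth_num 8 3 (by norm_num) (by norm_num)
  have h9 := hf.smooth_num 9 3 (by norm_num) (by norm_num)
  have h10 := hf.smooth_num 10 3 (by norm_num) (by norm_num)
  have h11 := hf.smooth_num 11 3 (by norm_num) (by norm_num)
  have h12 := hf.smooth_num 12 0 (by norm_num) (by norm_num)
  norm_num at hΨ h0 h1 h2 h3 h4 h5 h6 h7 h8 h9 h10 h11 h12
  linarith

theorem upper_bound_three : 15.555 ∈ taxLPValues 3 := by
  have h := mem_taxLPValues_of_table (i := 3)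
    [0, 15555, 30110, 59775, 113880, 215075, 349627, 525321, 762563, 1088153, 1497444, 2078131,
      3050130, 4961910, 9133141] 15555 4000 1000 11
    (by simp) (by norm_num [taxK]) (by norm_num) (by decide +kernel) (by decide +kernel)
    (by decide +kernel) (tailCoeff_le (by norm_num [refLam]) (by norm_num) (by norm_num [refLam]))
    (w := 0.46) (by norm_num) (by norm_num) (by norm_num)
  norm_num at h ⊢
  exact h

theorem smooth_of_tail_three {Ψ : ℝ} (hΨ : 15.545 ≤ Ψ) :
    ∀ n ≥ taxK, ∀ m : ℕ, (n : ℝ) ^ (3 + 1) ≤ Ψ * (m : ℝ) ^ (3 + 1)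
      - m * (tailCoeff 3 * ((n : ℝ) + 1) ^ 3) + n * (tailCoeff 3 * (n : ℝ) ^ 3) :=
  smooth_of_tail (lo := 2.8) (hi := 2.81) (w := 0.4) (by norm_num [refLam])
    (by norm_num [refLam]) (by norm_num) (by norm_num [refLam]) (by norm_num) (by norm_num)
    (by norm_num) (by norm_num) hΨ

theorem lower_bound_four : 55.445 ∈ lowerBounds (taxLPValues 4) := by
  rintro Ψ ⟨g, hf⟩
  by_contra! hΨ
  have h0 := hf.smooth_num 0 1 (by norm_num) (by norm_num)
  have h1 := hf.smooth_num 1 1 (by norm_num) (by norm_num)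
  have h2 := hf.smooth_num 2 1 (by norm_num) (by norm_num)
  have h3 := hf.smooth_num 3 1 (by norm_num) (by norm_num)
  have h4 := hf.smooth_num 4 1 (by norm_num) (by norm_num)
  have h5 := hf.smooth_num 5 2 (by norm_num) (by norm_num)
  have h6 := hf.smooth_num 6 2 (by norm_num) (by norm_num)
  have h7 := hf.smooth_num 7 2 (by norm_num) (by norm_num)
  have h8 := hf.smooth_num 8 2 (by norm_num) (by norm_num)
  have h9 := hf.smooth_num 9 3 (by norm_num) (by norm_num)
  have h10 := hf.smooth_num 10 3 (by norm_num) (by norm_num)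
  have h11 := hf.smooth_num 11 3 (by norm_num) (by norm_num)
  have h12 := hf.smooth_num 12 3 (by norm_num) (by norm_num)
  have h13 := hf.smooth_num 13 3 (by norm_num) (by norm_num)
  have h14 := hf.smooth_num 14 0 (by norm_num) (by norm_num)
  norm_num at hΨ h0 h1 h2 h3 h4 h5 h6 h7 h8 h9 h10 h11 h12 h13 h14
  linarith

theorem upper_bound_four : 55.455 ∈ taxLPValues 4 := by
  have h := mem_taxLPValues_of_table (i := 4)
    [0, 55455, 109910, 243275, 542280, 1200575, 2326217, 3977931, 6406538, 10129432, 15197151,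
      21815691, 30799055, 44385645, 65626576, 109433496, 211084863] 55455 5000 1000 10
    (by simp) (by norm_num [taxK]) (by norm_num) (by decide +kernel) (by decide +kernel)
    (by decide +kernel) (tailCoeff_le (by norm_num [refLam]) (by norm_num) (by norm_num [refLam]))
    (w := 0.42) (by norm_num) (by norm_num) (by norm_num)
  norm_num at h ⊢
  exact h

theorem smooth_of_tail_four {Ψ : ℝ} (hΨ : 55.445 ≤ Ψ) :
    ∀ n ≥ taxK, ∀ m : ℕ, (n : ℝ) ^ (4 + 1) ≤ Ψ * (m : ℝ) ^ (4 + 1)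
      - m * (tailCoeff 4 * ((n : ℝ) + 1) ^ 4) + n * (tailCoeff 4 * (n : ℝ) ^ 4) :=
  smooth_of_tail (lo := 3.08) (hi := 3.09) (w := 0.36) (by norm_num [refLam])
    (by norm_num [refLam]) (by norm_num) (by norm_num [refLam]) (by norm_num) (by norm_num)
    (by norm_num) (by norm_num) hΨ

theorem lower_bound_five : 220.395 ∈ lowerBounds (taxLPValues 5) := by
  rintro Ψ ⟨g, hf⟩
  by_contra! hΨ
  have h0 := hf.smooth_num 0 1 (by norm_num) (by norm_num)
  have h1 := hf.smooth_num 1 1 (by norm_num) (by norm_num)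
  have h2 := hf.smooth_num 2 1 (by norm_num) (by norm_num)
  have h3 := hf.smooth_num 3 1 (by norm_num) (by norm_num)
  have h4 := hf.smooth_num 4 1 (by norm_num) (by norm_num)
  have h5 := hf.smooth_num 5 2 (by norm_num) (by norm_num)
  have h6 := hf.smooth_num 6 2 (by norm_num) (by norm_num)
  have h7 := hf.smooth_num 7 2 (by norm_num) (by norm_num)
  have h8 := hf.smooth_num 8 2 (by norm_num) (by norm_num)
  have h9 := hf.smooth_num 9 3 (by norm_num) (by norm_num)
  have h10 := hf.smooth_num 10 3 (by norm_num) (by norm_num)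
  have h11 := hf.smooth_num 11 3 (by norm_num) (by norm_num)
  have h12 := hf.smooth_num 12 3 (by norm_num) (by norm_num)
  have h13 := hf.smooth_num 13 4 (by norm_num) (by norm_num)
  have h14 := hf.smooth_num 14 4 (by norm_num) (by norm_num)
  have h15 := hf.smooth_num 15 4 (by norm_num) (by norm_num)
  have h16 := hf.smooth_num 16 4 (by norm_num) (by norm_num)
  have h17 := hf.smooth_num 17 0 (by norm_num) (by norm_num)
  norm_num at hΨ h0 h1 h2 h3 h4 h5 h6 h7 h8 h9 h10 h11 h12 h13 h14 h15 h16 h17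
  linarith

theorem upper_bound_five : 220.405 ∈ taxLPValues 5 := by
  have h := mem_taxLPValues_of_table (i := 5)
    [0, 220405, 439810, 1036025, 2599480, 6522325, 15546272, 30363776, 54501676, 93987664,
      158374407, 248139771, 372883908, 549766047, 805732122, 1163373147, 1740687771, 2903523292,
      5733231017, 13244858331] 220405 6000 1000 11
    (by simp) (by norm_num [taxK]) (by norm_num) (by decide +kernel) (by decide +kernel)
    (by decide +kernel) (tailCoeff_le (by norm_num [refLam]) (by norm_num) (by norm_num [refLam]))
    (w := 0.38) (by norm_num) (by norm_num) (by norm_num)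
  norm_num at h ⊢
  exact h

theorem smooth_of_tail_five {Ψ : ℝ} (hΨ : 220.395 ≤ Ψ) :
    ∀ n ≥ taxK, ∀ m : ℕ, (n : ℝ) ^ (5 + 1) ≤ Ψ * (m : ℝ) ^ (5 + 1)
      - m * (tailCoeff 5 * ((n : ℝ) + 1) ^ 5) + n * (tailCoeff 5 * (n : ℝ) ^ 5) :=
  smooth_of_tail (lo := 3.31) (hi := 3.32) (w := 0.33) (by norm_num [refLam])
    (by norm_num [refLam]) (by norm_num) (by norm_num [refLam]) (by norm_num) (by norm_num)
    (by norm_num) (by norm_num) hΨ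

/-! ### Degree zero and the assembly of the theorem. -/

theorem tailCoeff_zero : tailCoeff 0 = 1 := by norm_num [tailCoeff, refLam]

theorem lower_bound_zero : 1 ∈ lowerBounds (taxLPValues 0) := by
  rintro Ψ ⟨g, hf⟩
  have h0 := hf.smooth_num 0 1 (by norm_num) (by norm_num)
  have h1 := hf.smooth_num 1 0 (by norm_num) (by norm_num)
  norm_num at h0 h1
  linarith

theorem upper_bound_zero : 1 ∈ taxLPValues 0 :=
  ⟨fun _ => 1, fun n m _ => by simp, by simp [tailCoeff_zero], fun _ => zero_le_one⟩

theorem smooth_of_tail_zero {Ψ : ℝ} (hΨ : 1 ≤ Ψ) :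
    ∀ n ≥ taxK, ∀ m : ℕ, (n : ℝ) ^ (0 + 1) ≤ Ψ * (m : ℝ) ^ (0 + 1)
      - m * (tailCoeff 0 * ((n : ℝ) + 1) ^ 0) + n * (tailCoeff 0 * (n : ℝ) ^ 0) := by
  intro n _ m
  rw [tailCoeff_zero]
  have := mul_le_mul_of_nonneg_right hΨ (m.cast_nonneg : (0 : ℝ) ≤ m)
  simp
  linarith

theorem tailCoeff_nonneg_of_le {i : ℕ} (hi : i ≤ 5) : 0 ≤ tailCoeff i :=
  TaxLPFeasible.tailCoeff_nonneg (by interval_cases i <;> norm_num [refLam])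

theorem taxLPValues_nonempty {i : ℕ} (hi : i ≤ 5) : (taxLPValues i).Nonempty := by
  interval_cases i
  exacts [⟨_, upper_bound_zero⟩, ⟨_, upper_bound_one⟩, ⟨_, upper_bound_two⟩,
    ⟨_, upper_bound_three⟩, ⟨_, upper_bound_four⟩, ⟨_, upper_bound_five⟩]

theorem isLeast_taxLPOpt_of_le {i : ℕ} (hi : i ≤ 5) : IsLeast (taxLPValues i) (taxLPOpt i) :=
  isLeast_taxLPOpt (tailCoeff_nonneg_of_le hi) (taxLPValues_nonempty hi)

theorem taxLPOpt_mem_Icc {i : ℕ} (hi : i ≤ 5) {a b : ℝ} (ha : a ∈ lowerBounds (taxLPValues i))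
    (hb : b ∈ taxLPValues i) : a ≤ taxLPOpt i ∧ taxLPOpt i ≤ b :=
  ⟨ha (isLeast_taxLPOpt_of_le hi).1, (isLeast_taxLPOpt_of_le hi).2 hb⟩

theorem taxLPOpt_zero : taxLPOpt 0 = 1 :=
  let h := taxLPOpt_mem_Icc (by norm_num) lower_bound_zero upper_bound_zero
  le_antisymm h.2 h.1

theorem taxLPOpt_one : 2.0115 ≤ taxLPOpt 1 ∧ taxLPOpt 1 ≤ 2.0125 :=
  taxLPOpt_mem_Icc (by norm_num) lower_bound_one upper_bound_one

theorem taxLPOpt_two : 5.095 ≤ taxLPOpt 2 ∧ taxLPOpt 2 ≤ 5.105 :=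
  taxLPOpt_mem_Icc (by norm_num) lower_bound_two upper_bound_two

theorem taxLPOpt_three : 15.545 ≤ taxLPOpt 3 ∧ taxLPOpt 3 ≤ 15.555 :=
  taxLPOpt_mem_Icc (by norm_num) lower_bound_three upper_bound_three

theorem taxLPOpt_four : 55.445 ≤ taxLPOpt 4 ∧ taxLPOpt 4 ≤ 55.455 :=
  taxLPOpt_mem_Icc (by norm_num) lower_bound_four upper_bound_four

theorem taxLPOpt_five : 220.395 ≤ taxLPOpt 5 ∧ taxLPOpt 5 ≤ 220.405 :=
  taxLPOpt_mem_Icc (by norm_num) lower_bound_five upper_bound_five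

/-- The numerical intervals are disjoint and increasing. This lets `Ψ_d` replace `Ψ_i` for the
monomials of lower degree. -/
theorem taxLPOpt_le {i d : ℕ} (hi : i ≤ d) (hd : d ≤ 5) : taxLPOpt i ≤ taxLPOpt d := by
  have h0 := taxLPOpt_zero
  have h1 := taxLPOpt_one
  have h2 := taxLPOpt_two
  have h3 := taxLPOpt_three
  have h4 := taxLPOpt_four
  have h5 := taxLPOpt_five
  interval_cases d <;> interval_cases i <;> first | exact le_rfl | linarith

theorem smooth_of_tail_taxLPOpt {i : ℕ} (hi : i ≤ 5) : ∀ n ≥ taxK, ∀ m : ℕ,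
    (n : ℝ) ^ (i + 1) ≤ taxLPOpt i * (m : ℝ) ^ (i + 1)
      - m * (tailCoeff i * ((n : ℝ) + 1) ^ i) + n * (tailCoeff i * (n : ℝ) ^ i) := by
  interval_cases i
  exacts [smooth_of_tail_zero taxLPOpt_zero.ge, smooth_of_tail_one taxLPOpt_one.1,
    smooth_of_tail_two taxLPOpt_two.1, smooth_of_tail_three taxLPOpt_three.1,
    smooth_of_tail_four taxLPOpt_four.1, smooth_of_tail_five taxLPOpt_five.1]

theorem loads_tailCoeff {i : ℕ} (hi : i ≤ 5) : RealProg.Loads (tailCoeff i) := by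
  obtain ⟨q, hq0, hq⟩ : ∃ q : ℚ, 0 ≤ q ∧ ((i : ℝ) + 1) * refLam i = q := by
    interval_cases i
    exacts [⟨1, by norm_num, by norm_num [refLam]⟩, ⟨4.024, by norm_num, by norm_num [refLam]⟩,
      ⟨15.3, by norm_num, by norm_num [refLam]⟩, ⟨62.2, by norm_num, by norm_num [refLam]⟩,
      ⟨277.25, by norm_num, by norm_num [refLam]⟩, ⟨1322.4, by norm_num, by norm_num [refLam]⟩]
  have h := (RealProg.loads_rat q).root (k := i + 1) (by omega) (by exact_mod_cast hq0)
  rw [tailCoeff, hq]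
  exact_mod_cast h

/-- The optimal solution that consists of the largest taxes. -/
noncomputable def optTax (i : ℕ) (n : Fin (taxK + 1)) : ℝ := maxTax i (taxLPOpt i) n

theorem isTaxLPSolution_optTax {i : ℕ} (hi : i ≤ 5) : IsTaxLPSolution i (optTax i) := by
  have h := isLeast_taxLPOpt_of_le hi
  obtain ⟨g, hg⟩ := h.1
  exact ⟨h.2, hg.maxTaxFeasible.taxLPFeasible (tailCoeff_nonneg_of_le hi)⟩

/-- The rationals `a` and `b` are built into the program, which does not solve the linear program;
only `ν_i` needs a root. -/
theorem loads_optTax {i : ℕ} (hi : i ≤ 5) (n : Fin (taxK + 1)) : RealProg.Loads (optTax i n) := by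
  obtain ⟨a, b, e⟩ := exists_maxTax_eq_add_mul_tailCoeff (tailCoeff_nonneg_of_le hi)
    (isLeast_taxLPOpt_of_le hi) n
  rw [optTax, e]
  exact (RealProg.loads_rat a).add ((RealProg.loads_rat b).mul (loads_tailCoeff hi))

theorem exists_computesTaxedCost_optTax :
    ∃ T : ℕ, ∀ d : ℕ, 1 ≤ d → d ≤ 5 → ∃ p : RealProg, p.ComputesTaxedCost d optTax T := by
  have h : ∀ d : ℕ, ∃ T : ℕ, d ≤ 5 → ∃ p : RealProg, p.ComputesTaxedCost d optTax T := by
    intro d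
    by_cases hd : d ≤ 5
    · obtain ⟨T, p, hp⟩ := RealProg.exists_computesTaxedCost (d := d) optTax
        (hd.trans (by norm_num [taxK])) (fun i hi => loads_optTax (hi.trans hd))
        (fun i hi => loads_tailCoeff (hi.trans hd))
      exact ⟨T, fun _ => ⟨p, hp⟩⟩
    · exact ⟨0, fun h => absurd h hd⟩
  choose T hT using h
  refine ⟨∑ d ∈ Finset.range 6, T d, fun d _ hd => ?_⟩
  obtain ⟨p, hp⟩ := hT d hd
  exact ⟨p, hp.mono (Finset.single_le_sum (f := T) (fun _ _ => Nat.zero_le _)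
    (Finset.mem_range.2 (by omega)))⟩

theorem IsTaxLPSolution.overlap {i d : ℕ} {g : Fin (taxK + 1) → ℝ} (hg : IsTaxLPSolution i g)
    (hi : i ≤ d) (hd : d ≤ 5) {n m k : ℕ} (hkn : k ≤ n) (hkm : k ≤ m) :
    ((m : ℝ) - k) * taxedMonomial i g (n + 1) + k * taxedMonomial i g n
      - n * taxedMonomial i g n + (n : ℝ) ^ (i + 1) ≤ taxLPOpt d * (m : ℝ) ^ (i + 1) := by
  have hi5 := hi.trans hd
  refine (hg.2.overlap (taxLPOpt_zero.symm.trans_le (taxLPOpt_le (Nat.zero_le i) hi5))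
    (fun h => ?_) (tailCoeff_nonneg_of_le hi5) (smooth_of_tail_taxLPOpt hi5) hkn hkm).trans
    (mul_le_mul_of_nonneg_right (taxLPOpt_le hi hd) (by positivity))
  rw [h, taxLPOpt_zero]

theorem CongestionGame.isSmooth_taxed {P E : Type*} [Fintype P] [DecidableEq P] [Fintype E]
    [DecidableEq E] {d : ℕ} (hd : d ≤ 5) {g : ℕ → Fin (taxK + 1) → ℝ}
    (hg : ∀ i ≤ d, IsTaxLPSolution i (g i)) (G : CongestionGame P E) (f : E → Polynomial ℝ)
    (hf : ∀ e, (f e).natDegree ≤ d) (hf0 : ∀ e i, 0 ≤ (f e).coeff i)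
    (hG : ∀ e (n : ℕ), G.cost e n = (f e).eval (n : ℝ)) :
    (G.taxed g f).toStrategicGame.IsSmooth (taxLPOpt d) 0 G.socialCost := by
  refine isSmooth_of_resource G _ fun e n m k hkn hkm => ?_
  rw [hG, hG]
  exact taxedCost_overlap g (hf e) (hf0 e) fun i hi => (hg i hi).overlap hi hd hkn hkm

theorem mainTheorem5 :
    -- the linear programs have optimal solutions
    (∀ i : ℕ, i ≤ 5 → IsLeast (taxLPValues i) (taxLPOpt i)) ∧
    -- the optimal values
    (|taxLPOpt 1 - 2.012| ≤ 0.0005 ∧ |taxLPOpt 2 - 5.10| ≤ 0.005 ∧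
      |taxLPOpt 3 - 15.55| ≤ 0.005 ∧ |taxLPOpt 4 - 55.45| ≤ 0.005 ∧
      |taxLPOpt 5 - 220.40| ≤ 0.005) ∧
    -- optimal solutions, and from them the taxed cost functions, are computed in constant time
    (∃ g : ℕ → Fin (taxK + 1) → ℝ, (∀ i : ℕ, i ≤ 5 → IsTaxLPSolution i (g i)) ∧
      ∃ T : ℕ, ∀ d : ℕ, 1 ≤ d → d ≤ 5 → ∃ p : RealProg, p.ComputesTaxedCost d g T) ∧
    -- every choice of optimal solutions gives a smooth game, with the resulting price of anarchy
    (∀ d : ℕ, 1 ≤ d → d ≤ 5 →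
      ∀ g : ℕ → Fin (taxK + 1) → ℝ, (∀ i : ℕ, i ≤ d → IsTaxLPSolution i (g i)) →
      ∀ (P E : Type*) [Fintype P] [DecidableEq P] [Fintype E] [DecidableEq E]
        (G : CongestionGame P E) (f : E → Polynomial ℝ),
        (∀ e, (f e).natDegree ≤ d) → (∀ e i, 0 ≤ (f e).coeff i) →
        (∀ e (n : ℕ), G.cost e n = (f e).eval (n : ℝ)) →
        (∀ e n, 0 ≤ (G.taxed g f).cost e n) ∧
        (G.taxed g f).toStrategicGame.IsSmooth (taxLPOpt d) 0 G.socialCost ∧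
        (∀ s t : P → Finset E, (G.taxed g f).toStrategicGame.IsPureNash s →
          G.toStrategicGame.IsState t → G.socialCost s ≤ taxLPOpt d * G.socialCost t)) := by
  refine ⟨fun i hi => isLeast_taxLPOpt_of_le hi, ⟨?_, ?_, ?_, ?_, ?_⟩,
    ⟨optTax, fun i hi => isTaxLPSolution_optTax hi, exists_computesTaxedCost_optTax⟩, ?_⟩
  · have := taxLPOpt_one
    rw [abs_le]; constructor <;> linarith
  · have := taxLPOpt_two
    rw [abs_le]; constructor <;> linarith
  · have := taxLPOpt_three
    rw [abs_le]; constructor <;> linarith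
  · have := taxLPOpt_four
    rw [abs_le]; constructor <;> linarith
  · have := taxLPOpt_five
    rw [abs_le]; constructor <;> linarith
  · intro d _ hd g hg P E _ _ _ _ G f hf hf0 hG
    have hs := CongestionGame.isSmooth_taxed hd hg G f hf hf0 hG
    refine ⟨fun e n => ?_, hs, fun s t hn ht => hs.le_of_isPureNash hn ht⟩
    change 0 ≤ taxedCost g (f e) n
    rw [taxedCost_eq_sum g (hf e)]
    refine Finset.sum_nonneg fun i hi => mul_nonneg (hf0 e i) ?_
    have hi' : i ≤ d := Nat.lt_succ_iff.1 (Finset.mem_range.1 hi)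
    exact (hg i hi').2.taxedMonomial_nonneg (tailCoeff_nonneg_of_le (hi'.trans hd)) n
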